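/- All simplicial complexes are finite abstract simplicial complexes, $\langle F_1,\dots,F_m\rangle$ denotes the complex of all subsets of the sets $F_i$, and $\Delta*\Gamma=\{F\cup G: F\in\Delta,\ G\in\Gamma\}$ is the join of complexes with disjoint vertex sets. Let $V=\{v_i,x_i,y_i,z_i : i=1,2,3\}$ (twelve distinct vertices) and, for triples of distinct vertices, put $$\Diamond([p_1,p_2,p_3],[q_1,q_2,q_3])=\langle\{p_1\},\{q_1\}\rangle*\langle\{p_2\},\{q_2\}\rangle*\langle\{p_3\},\{q_3\}\rangle .$$ Let $$\Gamma_1=\langle\{v_1\}\rangle*\Diamond([x_1,x_2,x_3],[y_1,y_2,y_3])\ \cup\ \langle\{v_2\}\rangle*\Diamond([y_1,y_2,y_3],[z_1,z_2,z_3])\ \cup\ \langle\{v_3\}\rangle*\Diamond([x_1,x_2,x_3],[z_3,z_1,z_2]),$$ and, writing $(a_1,a_2,a_3)=(z_2,z_3,z_1)$, $(b_1,b_2,b_3)=(y_3,y_1,y_2)$, $(c_1,c_2,c_3)=(x_1,x_2,x_3)$, let $\Gamma_2$ be the complex with the nine facets $$\{a_i,b_i,c_i,c_j\},\quad \{a_i,b_i,b_j,c_j\},\quad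 \{a_i,a_j,b_j,c_j\},\qquad (i,j)\in\{(1,2),(2,3),(3,1)\}.$$ Put $\Delta_{12,33}=\Gamma_1\cup\Gamma_2$ (a complex with $12$ vertices and $33$ facets). For $k\ge 1$ let $\Delta_{12,33}^k=\Delta_{12,33}*\cdots*\Delta_{12,33}$ be the join of $k$ disjoint copies of $\Delta_{12,33}$. Terminology. A complex is a simplicial $d$-sphere if its geometric realization is homeomorphic to $\mathbb S^d$. A complex on a vertex set $V$ is flag if every inclusion-minimal subset of $V$ that is not a face has exactly two elements. A complex is a suspension if it has the form $\Gamma*\langle\{a\},\{b\}\rangle$ with $a\neq b$ not vertices of $\Gamma$. An edge is contractible if it is not contained in any induced $4$-cycle, that is, in any induced subcomplex that is a $4$-cycle. An induced equator of a simplicial $n$-sphere $\Delta$ is an induced subcomplex $\Delta[W]=\{F\in\Delta: F\subseteq W\}$ that is a simplicial $(n-1)$-sphere. The link of a vertex $v$ is $\{G\in\Delta: v\notin G,\ G\cup\{v\}\in\Delta\}$. Corollary. For every $k\ge 1$, the $k$-fold join $\Delta_{12,33}^k$ is a flag simplicial $(4k-1)$-sphere such that - $\Delta_{12,33}^k$ is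 not a suspension and has no contractible edge; - every induced equator of $\Delta_{12,33}^k$ is the link of a vertex of $\Delta_{12,33}^k$. -/

import Mathlib

/- Simplicial complexes are Mathlib's `PreAbstractSimplicialComplex V`: down-closed families of
nonempty finite sets (not every element of `V` has to be a vertex). The empty face, which belongs to
every complex in the convention of combinatorics, is left implicit there: a complex `Δ` with its
empty face corresponds to the family of its nonempty faces, and `⊥` stands for `{∅}`. -/

namespace FlagSphere

/-- `F` is a face of `K`, the empty face included. -/
def IsFace {V : Type*} (K : PreAbstractSimplicialComplex V) (F : Finset V) : Prop :=
  F = ∅ ∨ F ∈ K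

/-- The complex `⟨F₁, …, F_m⟩` generated by a family of sets: all subsets of its members. -/
def generatedBy {V : Type*} (𝓕 : Set (Finset V)) : PreAbstractSimplicialComplex V where
  faces := {s | s.Nonempty ∧ ∃ f ∈ 𝓕, s ⊆ f}
  isRelLowerSet_faces := by
    rintro s ⟨hs, f, hf, hsf⟩
    exact ⟨hs, fun t hts ht => ⟨ht, f, hf, hts.trans hsf⟩⟩

/-- The join `K * L = {F ∪ G : F ∈ K, G ∈ L}` of complexes on a common ground set
(used for complexes with disjoint vertex sets). -/
def join {V : Type*} [DecidableEq V] (K L : PreAbstractSimplicialComplex V) :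
    PreAbstractSimplicialComplex V where
  faces := {s | s.Nonempty ∧ ∃ F G : Finset V, IsFace K F ∧ IsFace L G ∧ s = F ∪ G}
  isRelLowerSet_faces := by
    have key : ∀ (M : PreAbstractSimplicialComplex V) (F t : Finset V),
        IsFace M F → IsFace M (F ∩ t) := by
      intro M F t hF
      rcases (F ∩ t).eq_empty_or_nonempty with h | h
      · exact Or.inl h
      · rcases hF with rfl | hF
        · simp at h
        · exact Or.inr ((M.isRelLowerSet_faces hF).2 Finset.inter_subset_left h)
    rintro s ⟨hs, F, G, hF, hG, rfl⟩
    refine ⟨hs, fun t hts ht => ⟨ht, F ∩ t, G ∩ t, key K F t hF, key L G t hG, ?_⟩⟩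
    rw [← Finset.union_inter_distrib_right]
    exact (Finset.inter_eq_right.2 hts).symm

/-- The join `K₁ * ⋯ * K_m` of a finite family of complexes on a common ground set: its faces are
the unions `⋃ i, F i` with `F i ∈ K i` (used for complexes with pairwise disjoint vertex sets). -/
def iJoin {ι V : Type*} [Fintype ι] [DecidableEq V] (K : ι → PreAbstractSimplicialComplex V) :
    PreAbstractSimplicialComplex V where
  faces := {s | s.Nonempty ∧ ∃ F : ι → Finset V,
    (∀ i, IsFace (K i) (F i)) ∧ s = Finset.univ.biUnion F}
  isRelLowerSet_faces := by
    have key : ∀ (M : PreAbstractSimplicialComplex V) (F t : Finset V),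
        IsFace M F → IsFace M (F ∩ t) := by
      intro M F t hF
      rcases (F ∩ t).eq_empty_or_nonempty with h | h
      · exact Or.inl h
      · rcases hF with rfl | hF
        · simp at h
        · exact Or.inr ((M.isRelLowerSet_faces hF).2 Finset.inter_subset_left h)
    rintro s ⟨hs, F, hF, rfl⟩
    refine ⟨hs, fun t hts ht => ⟨ht, fun i => F i ∩ t, fun i => key (K i) (F i) t (hF i), ?_⟩⟩
    rw [← Finset.biUnion_inter]
    exact (Finset.inter_eq_right.2 hts).symm

/-- The `k`-fold join `K * ⋯ * K`: the join of the `k` disjoint copies `{i} × K` of `K`, `i < k`. -/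
def joinPower {V : Type*} [DecidableEq V] (k : ℕ) (K : PreAbstractSimplicialComplex V) :
    PreAbstractSimplicialComplex (Fin k × V) :=
  iJoin fun i : Fin k => K.map fun v => (i, v)

/-- The induced subcomplex `K[W] = {F ∈ K : F ⊆ W}`. -/
def induced {V : Type*} (K : PreAbstractSimplicialComplex V) (W : Finset V) :
    PreAbstractSimplicialComplex V where
  faces := {s | s ∈ K ∧ s ⊆ W}
  isRelLowerSet_faces := by
    rintro s ⟨hs, hsW⟩
    exact ⟨(K.isRelLowerSet_faces hs).1, fun t hts ht =>
      ⟨(K.isRelLowerSet_faces hs).2 hts ht, hts.trans hsW⟩⟩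

/-- The link `{G ∈ K : F ∪ G ∈ K, F ∩ G = ∅}` of `F` in `K`. -/
def link {V : Type*} [DecidableEq V] (K : PreAbstractSimplicialComplex V) (F : Finset V) :
    PreAbstractSimplicialComplex V where
  faces := {G | G ∈ K ∧ F ∪ G ∈ K ∧ F ∩ G = ∅}
  isRelLowerSet_faces := by
    rintro G ⟨hG, hFG, hd⟩
    refine ⟨(K.isRelLowerSet_faces hG).1, fun t hts ht =>
      ⟨(K.isRelLowerSet_faces hG).2 hts ht, ?_, ?_⟩⟩
    · exact (K.isRelLowerSet_faces hFG).2 (Finset.union_subset_union_right hts)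
        (ht.mono Finset.subset_union_right)
    · exact Finset.subset_empty.1 (hd ▸ Finset.inter_subset_inter_left hts)

/-- The geometric realization `|K|`, in barycentric coordinates, as a subspace of `ℝ^V`. -/
def realization {V : Type*} [Fintype V] (K : PreAbstractSimplicialComplex V) : Set (V → ℝ) :=
  {w | (∀ v, 0 ≤ w v) ∧ ∑ v, w v = 1 ∧ ∃ s ∈ K, ∀ v, w v ≠ 0 → v ∈ s}

/-- `K` is a simplicial `d`-sphere: `|K|` is homeomorphic to the unit sphere of `ℝ^(d+1)`. -/
def IsSimplicialSphere {V : Type*} [Fintype V] (d : ℕ) (K : PreAbstractSimplicialComplex V) :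
    Prop :=
  Nonempty (realization K ≃ₜ Metric.sphere (0 : EuclideanSpace ℝ (Fin (d + 1))) 1)

/-- `K` is flag: every inclusion-minimal non-face, among all subsets of `V`, has cardinality `2`. -/
def IsFlag {V : Type*} (K : PreAbstractSimplicialComplex V) : Prop :=
  ∀ F : Finset V, ¬ IsFace K F → (∀ G : Finset V, G ⊂ F → IsFace K G) → F.card = 2

/-- `K` is a suspension: `K = L * ⟨{a}, {b}⟩` for two distinct points `a`, `b` that are
not vertices of `L`. -/
def IsSuspension {V : Type*} [DecidableEq V] (K : PreAbstractSimplicialComplex V) : Prop :=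
  ∃ (L : PreAbstractSimplicialComplex V) (a b : V), a ≠ b ∧ {a} ∉ L ∧ {b} ∉ L ∧
    K = join L (generatedBy {{a}, {b}})

/-- The subcomplex of `K` induced on `W` is a 4-cycle with vertex set `W`. -/
def IsInducedFourCycle {V : Type*} [DecidableEq V] (K : PreAbstractSimplicialComplex V)
    (W : Finset V) : Prop :=
  ∃ a b c d : V, [a, b, c, d].Nodup ∧ W = {a, b, c, d} ∧
    induced K W = generatedBy {{a, b}, {b, c}, {c, d}, {d, a}}

/-- `e` is a contractible edge of `K`: an edge contained in no induced 4-cycle of `K`. -/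
def IsContractibleEdge {V : Type*} [DecidableEq V] (K : PreAbstractSimplicialComplex V)
    (e : Finset V) : Prop :=
  e ∈ K ∧ e.card = 2 ∧ ¬ ∃ W : Finset V, IsInducedFourCycle K W ∧ e ⊆ W

/-- `E` is an induced equator of the simplicial `n`-sphere `K`: an induced subcomplex of `K`
that is a simplicial sphere of dimension `n - 1`. -/
def IsInducedEquator {V : Type*} [Fintype V] (n : ℕ) (K E : PreAbstractSimplicialComplex V) :
    Prop :=
  (∃ W : Finset V, E = induced K W) ∧ ∃ d : ℕ, d + 1 = n ∧ IsSimplicialSphere d E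

/-- `E` is the link of a vertex of `K`. -/
def IsVertexLink {V : Type*} [DecidableEq V] (K E : PreAbstractSimplicialComplex V) : Prop :=
  ∃ v : V, {v} ∈ K ∧ E = link K {v}

/-- The boundary complex `◇([p₁, …, p_d], [q₁, …, q_d])` of a cross-polytope: the join of the
`0`-spheres `⟨{p_i}, {q_i}⟩`. -/
def diamond {V : Type*} [DecidableEq V] {d : ℕ} (p q : Fin d → V) :
    PreAbstractSimplicialComplex V :=
  iJoin fun i : Fin d => generatedBy {{p i}, {q i}}

/-- The twelve vertices `v₁, v₂, v₃, x₁, x₂, x₃, y₁, y₂, y₃, z₁, z₂, z₃`, coded as pairs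
(letter, index); the index is counted from `0`, so that `x 0` is `x₁`. -/
abbrev Vertex : Type := Fin 4 × Fin 3

def v (i : Fin 3) : Vertex := (0, i)
def x (i : Fin 3) : Vertex := (1, i)
def y (i : Fin 3) : Vertex := (2, i)
def z (i : Fin 3) : Vertex := (3, i)

/-- The solid torus `Γ₁`: a union of three cones over octahedra. -/
def Gamma1 : PreAbstractSimplicialComplex Vertex :=
  join (generatedBy {{v 0}}) (diamond x y) ⊔
  join (generatedBy {{v 1}}) (diamond y z) ⊔
  join (generatedBy {{v 2}}) (diamond x ![z 2, z 0, z 1])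

/-- The vertices `φ(a_i)`, `φ(b_i)`, `φ(c_i)` of `Γ₂`, where `a_i, b_i, c_i` are the vertices
`(a, i), (b, i), (c, i)` of the staircase triangulation of (triangle) `×` (3-cycle). -/
def a : Fin 3 → Vertex := ![z 1, z 2, z 0]
def b : Fin 3 → Vertex := ![y 2, y 0, y 1]
def c : Fin 3 → Vertex := ![x 0, x 1, x 2]

/-- The solid torus `Γ₂`: three prisms, each triangulated by three staircases. -/
def Gamma2 : PreAbstractSimplicialComplex Vertex :=
  generatedBy
    {{a 0, b 0, c 0, c 1}, {a 0, b 0, b 1, c 1}, {a 0, a 1, b 1, c 1},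
     {a 1, b 1, c 1, c 2}, {a 1, b 1, b 2, c 2}, {a 1, a 2, b 2, c 2},
     {a 2, b 2, c 2, c 0}, {a 2, b 2, b 0, c 0}, {a 2, a 0, b 0, c 0}}

/-- The complex `Δ_{12,33} = Γ₁ ∪ Γ₂`. -/
def Delta1233 : PreAbstractSimplicialComplex Vertex := Gamma1 ⊔ Gamma2

end FlagSphere

/-! Everything about `Delta1233` itself is a finite check, and two topological facts carry it to the
joins and their equators: a join of spheres is a sphere, and a triangulated sphere is a closed
pseudomanifold.

Sphere: bistellar flips turn `Delta1233` into the boundary of the 4-dimensional cross-polytope. Each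
flip is a stellar subdivision followed by the inverse of another, so it preserves the realization up
to homeomorphism (`checkFlips_flips`, `nonempty_homeomorph_of_checkFlips`). For the `k`-fold join,
realizations are replaced by the cones over them. The cone over a join is the product of the cones,
and the cone over a `d`-sphere is a `(d+1)`-dimensional space (`ConeHomeo.joinPower`).

Flagness, suspensions, edges: `Delta1233` is the clique complex of its graph, so faces of the join
are described by adjacency within each copy. Every vertex has at least two non-neighbours, which
excludes suspensions. An edge inside one copy lies in an induced 4-cycle by inspection; an edge
between two copies does because each endpoint has a non-neighbour in its own copy.

Equators: by invariance of domain, in a triangulated `d`-sphere all facets have `d + 1` vertices and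
every face with `d` vertices lies in exactly two facets
(`IsSimplicialSphere.isClosedPseudomanifold`). This combinatorial property passes from a join to its
factors (`IsClosedPseudomanifold.exists_of_join`). An induced equator is the join of its traces on
the copies. Each trace has facets of at most 4 vertices and the sizes add up to `4 * k - 1`, so one
trace has size 3 and all others size 4. Running over all vertex subsets of `Delta1233` shows that
size 4 forces the whole vertex set and size 3 forces the neighbours of a vertex. Hence the equator
is induced on the neighbours of one vertex of the join, and by flagness it is the link of that
vertex.

Invariance of domain is derived from a Brouwer-type theorem, itself proved by the change of
variables formula. -/

/-! ### Change of variables: the integral of the Jacobian of a perturbed identity -/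

open MeasureTheory Set Metric Polynomial in
theorem exists_poly_det_one_add_smul {E : Type*} [NormedAddCommGroup E] [NormedSpace ℝ E]
    [FiniteDimensional ℝ E] (A : E →L[ℝ] E) :
    ∃ p : ℝ[X], p.natDegree ≤ Module.finrank ℝ E ∧
      ∀ t : ℝ, p.eval t = (1 + t • A : E →L[ℝ] E).det := by
  classical
  let b := Module.finBasis ℝ E
  let M := LinearMap.toMatrix b b (A : E →ₗ[ℝ] E)
  refine ⟨Matrix.det ((X : ℝ[X]) • M.map C + (1 : Matrix _ _ ℝ).map C), ?_, fun t => ?_⟩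
  · simpa using Polynomial.natDegree_det_X_add_C_le M 1
  · rw [ContinuousLinearMap.det, ← LinearMap.det_toMatrix b, ← Polynomial.coe_evalRingHom,
      RingHom.map_det]
    congr 1
    have : ((1 + t • A : E →L[ℝ] E) : E →ₗ[ℝ] E) = LinearMap.id + t • (A : E →ₗ[ℝ] E) := by
      ext; simp
    rw [this, (LinearMap.toMatrix b b).map_add, (LinearMap.toMatrix b b).map_smul,
      LinearMap.toMatrix_id]
    ext i j
    simp [M, Matrix.one_apply, add_comm]
    split_ifs <;> simp [mul_comm]

-- Lagrange interpolation at `n + 1` distinct nodes in `(0, ε)`, extrapolated to 1. It transfers an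
-- identity that is polynomial in `t` from small `t` to `t = 1`.
open Polynomial in
theorem exists_weights_eval_one (n : ℕ) {ε : ℝ} (hε : 0 < ε) :
    ∃ t c : Fin (n + 1) → ℝ, (∀ j, 0 < t j ∧ t j < ε) ∧
      ∀ p : ℝ[X], p.natDegree ≤ n → p.eval 1 = ∑ j, c j * p.eval (t j) := by
  let t : Fin (n + 1) → ℝ := fun j => ε * ((j + 1) / (n + 2))
  have hinj : Function.Injective t := by
    intro i j hij
    have h2 : (n : ℝ) + 2 ≠ 0 := by positivity
    simp only [t] at hij
    field_simp at hij
    exact Fin.ext (by exact_mod_cast add_right_cancel hij)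
  refine ⟨t, fun j => (Lagrange.basis Finset.univ t j).eval 1, fun j => ⟨by positivity, ?_⟩,
    fun p hp => ?_⟩
  · have hj : ((j : ℕ) : ℝ) ≤ n := by exact_mod_cast Nat.lt_succ_iff.1 j.2
    have : ((j : ℕ) + 1 : ℝ) / (n + 2) < 1 := by
      rw [div_lt_one (by positivity)]; linarith
    calc t j < ε * 1 := mul_lt_mul_of_pos_left this hε
      _ = ε := mul_one _
  · have hdeg : p.degree < (Finset.univ : Finset (Fin (n + 1))).card := by
      refine lt_of_le_of_lt degree_le_natDegree ?_
      rw [Finset.card_univ, Fintype.card_fin]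
      exact_mod_cast Nat.lt_succ_of_le hp
    conv_lhs => rw [Lagrange.eq_interpolate hinj.injOn hdeg, Lagrange.interpolate_apply]
    simp [eval_finsetSum, mul_comm]

section Brouwer

open MeasureTheory Set Metric Polynomial
open scoped NNReal Topology

variable {E : Type*} [NormedAddCommGroup E] [NormedSpace ℝ E] [FiniteDimensional ℝ E]

/-- Along the segment `1 + t • A` with `0 ≤ t ≤ 1` the determinant never vanishes, by the Neumann
series, and it is 1 at `t = 0`; the intermediate value theorem fixes its sign. -/
theorem det_one_add_pos_of_norm_lt_one {A : E →L[ℝ] E} (hA : ‖A‖ < 1) :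
    0 < (1 + A : E →L[ℝ] E).det := by
  obtain ⟨p, -, hp⟩ := exists_poly_det_one_add_smul A
  have hne : ∀ t ∈ Icc (0 : ℝ) 1, p.eval t ≠ 0 := by
    intro t ht
    rw [hp]
    have hn : ‖t • -A‖ < 1 := by
      rw [norm_smul, norm_neg, Real.norm_eq_abs, abs_of_nonneg ht.1]
      exact lt_of_le_of_lt (mul_le_of_le_one_left (norm_nonneg _) ht.2) hA
    have hu : IsUnit (1 + t • A : E →L[ℝ] E) := by
      have := isUnit_one_sub_of_norm_lt_one hn
      rwa [smul_neg, sub_neg_eq_add] at this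
    have := hu.map (ContinuousLinearMap.toLinearMapRingHom : (E →L[ℝ] E) →+* (E →ₗ[ℝ] E))
    exact (this.map LinearMap.det).ne_zero
  have h0 : p.eval 0 = 1 := by
    rw [hp, zero_smul, add_zero]; simp [ContinuousLinearMap.det]
  have h1 : p.eval 1 = (1 + A : E →L[ℝ] E).det := by rw [hp, one_smul]
  rw [← h1]
  by_contra hneg
  obtain ⟨t, ht, h⟩ := intermediate_value_Icc' (f := fun t => p.eval t) zero_le_one
    p.continuous.continuousOn (show (0 : ℝ) ∈ Icc (p.eval 1) (p.eval 0) from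
      ⟨not_lt.1 hneg, by rw [h0]; exact zero_le_one⟩)
  exact hne t ht h

/-- A small multiple of a Lipschitz map is a bijective perturbation of the identity. -/
theorem bijective_id_add_smul_of_lipschitz {g : E → E} {K : ℝ≥0} (hg : LipschitzWith K g)
    {t : ℝ} (ht : 0 < t) (htK : t * K < 1) :
    Function.Bijective fun x => x + t • g x := by
  have happ : ApproximatesLinearOn (fun x => x + t • g x)
      ((ContinuousLinearEquiv.refl ℝ E : E ≃L[ℝ] E) : E →L[ℝ] E) univ (Real.toNNReal t * K) := by
    rw [ApproximatesLinearOn.approximatesLinearOn_iff_lipschitzOnWith]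
    refine LipschitzOnWith.of_dist_le_mul fun x _ y _ => ?_
    simp only [Pi.sub_apply, ContinuousLinearEquiv.coe_coe, ContinuousLinearEquiv.coe_refl',
      id_eq, add_sub_cancel_left, NNReal.coe_mul, Real.coe_toNNReal _ ht.le]
    rw [dist_smul₀, Real.norm_eq_abs, abs_of_pos ht, mul_assoc]
    exact mul_le_mul_of_nonneg_left (hg.dist_le_mul x y) ht.le
  have hc : Subsingleton E ∨ Real.toNNReal t * K <
      ‖((ContinuousLinearEquiv.refl ℝ E).symm : E →L[ℝ] E)‖₊⁻¹ := by
    rcases subsingleton_or_nontrivial E with h | h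
    · exact Or.inl h
    · right
      have : ‖((ContinuousLinearEquiv.refl ℝ E).symm : E →L[ℝ] E)‖₊ = 1 := by
        rw [ContinuousLinearEquiv.refl_symm]
        exact NNReal.eq ContinuousLinearMap.norm_id
      rw [this, inv_one, ← NNReal.coe_lt_coe, NNReal.coe_mul, Real.coe_toNNReal _ ht.le]
      exact_mod_cast htK
  exact ⟨injOn_univ.1 (happ.injOn hc), happ.surjective hc⟩

variable [MeasurableSpace E] [BorelSpace E] (μ : Measure E) [μ.IsAddHaarMeasure]

/-- For small `t` the map `x + t • g x` is a bijection fixing the complement of the ball, so it maps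
the ball onto itself and the integral of its Jacobian is the volume. The Jacobian is polynomial in
`t`, so the identity persists at `t = 1`, where bijectivity may fail. -/
theorem integral_det_one_add_fderiv_of_lipschitz {g : E → E} {K : ℝ≥0} (hg : LipschitzWith K g)
    {R : ℝ} (h0 : ∀ x, x ∉ ball (0 : E) R → g x = 0)
    (hd : ∀ x ∈ ball (0 : E) R, DifferentiableAt ℝ g x) :
    ∫ x in ball (0 : E) R, (1 + fderiv ℝ g x : E →L[ℝ] E).det ∂μ = μ.real (ball (0 : E) R) := by
  set B := ball (0 : E) R
  have hsmall : ∀ t : ℝ, 0 < t → t * K < 1 →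
      IntegrableOn (fun x => (1 + t • fderiv ℝ g x : E →L[ℝ] E).det) B μ ∧
      ∫ x in B, (1 + t • fderiv ℝ g x : E →L[ℝ] E).det ∂μ = μ.real B := by
    intro t ht htK
    have hbij := bijective_id_add_smul_of_lipschitz hg ht htK
    set φ : E → E := fun x => x + t • g x with hφ
    have himg : φ '' B = B := by
      have hc : φ '' Bᶜ = Bᶜ := by
        have : EqOn φ id Bᶜ := fun x hx => by simp [hφ, h0 x hx]
        rw [this.image_eq, image_id]
      have := image_compl_eq (s := B) hbij
      rw [hc] at this
      exact (compl_injective this).symm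
    have hder : ∀ x ∈ B, HasFDerivWithinAt φ (1 + t • fderiv ℝ g x : E →L[ℝ] E) B x := by
      intro x hx
      exact ((hasFDerivAt_id x).add ((hd x hx).hasFDerivAt.const_smul t)).hasFDerivWithinAt
    have hpos : ∀ x, 0 < (1 + t • fderiv ℝ g x : E →L[ℝ] E).det := by
      intro x
      refine det_one_add_pos_of_norm_lt_one ?_
      rw [norm_smul, Real.norm_eq_abs, abs_of_pos ht]
      exact lt_of_le_of_lt (mul_le_mul_of_nonneg_left (norm_fderiv_le_of_lipschitz ℝ hg) ht.le) htK
    have habs : ∀ x, |(1 + t • fderiv ℝ g x : E →L[ℝ] E).det| • (1 : ℝ) =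
        (1 + t • fderiv ℝ g x : E →L[ℝ] E).det := fun x => by
      rw [abs_of_pos (hpos x), smul_eq_mul, mul_one]
    constructor
    · have := (integrableOn_image_iff_integrableOn_abs_det_fderiv_smul μ measurableSet_ball hder
        hbij.1.injOn (fun _ => (1 : ℝ))).1 (by
          change IntegrableOn _ (φ '' B) μ
          rw [himg]; exact integrableOn_const (measure_ball_lt_top.ne))
      simpa only [habs] using this
    · have := integral_image_eq_integral_abs_det_fderiv_smul μ measurableSet_ball hder
        hbij.1.injOn (fun _ => (1 : ℝ))
      change ∫ x in φ '' B, (1 : ℝ) ∂μ = _ at this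
      rw [himg] at this
      simp only [habs] at this
      rw [← this]; simp
  obtain ⟨ε, hε, hεK⟩ : ∃ ε : ℝ, 0 < ε ∧ ε * K < 1 := by
    refine ⟨1 / (K + 1), by positivity, ?_⟩
    have hK : (0 : ℝ) ≤ K := K.2
    rw [div_mul_eq_mul_div, one_mul, div_lt_one (by positivity)]; linarith
  obtain ⟨t, c, ht, hc⟩ := exists_weights_eval_one (Module.finrank ℝ E) hε
  have htK : ∀ j, t j * K < 1 := fun j =>
    lt_of_le_of_lt (mul_le_mul_of_nonneg_right (ht j).2.le K.2) hεK
  -- The weights do not depend on `x`, so the integrand is a fixed combination of integrands already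
  -- known to be integrable.
  have key : ∀ x, (1 + fderiv ℝ g x : E →L[ℝ] E).det =
      ∑ j, c j * (1 + t j • fderiv ℝ g x : E →L[ℝ] E).det := by
    intro x
    obtain ⟨p, hp, hpe⟩ := exists_poly_det_one_add_smul (fderiv ℝ g x)
    have := hc p hp
    simpa only [hpe, one_smul] using this
  have hsum : ∑ j, c j = 1 := by simpa using (hc 1 (by simp)).symm
  simp only [key]
  rw [integral_finsetSum _ fun j _ => ((hsmall (t j) (ht j).1 (htK j)).1.const_mul (c j))]
  simp only [integral_const_mul, (hsmall _ (ht _).1 (htK _)).2]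
  rw [← Finset.sum_mul, hsum, one_mul]

end Brouwer

/-! ### Brouwer's fixed point theorem -/

section InvarianceOfDomain

open MeasureTheory Set Metric
open scoped NNReal Topology RealInnerProductSpace

/-- A segment leaving the ball meets the sphere, where `g` vanishes; comparing with that point gives
the bound across the boundary with the same constant. -/
theorem lipschitzWith_indicator_ball {E F : Type*} [NormedAddCommGroup E] [NormedSpace ℝ E]
    [NormedAddCommGroup F] {g : E → F} {K : ℝ≥0} {R : ℝ}
    (hg : LipschitzOnWith K g (closedBall 0 R)) (h0 : ∀ x ∈ sphere (0 : E) R, g x = 0) :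
    LipschitzWith K ((ball (0 : E) R).indicator g) := by
  have key : ∀ x ∈ ball (0 : E) R, ∀ y ∉ ball (0 : E) R, dist (g x) 0 ≤ K * dist x y := by
    intro x hx y hy
    have hcont : ContinuousOn (fun t : ℝ => ‖AffineMap.lineMap x y t‖) (Icc 0 1) := by
      fun_prop
    obtain ⟨t, ht, hs⟩ := intermediate_value_Icc zero_le_one hcont (show R ∈ Icc _ _ from
      ⟨by simpa using (mem_ball_zero_iff.1 hx).le, by simpa using hy⟩)
    have hs' : AffineMap.lineMap x y t ∈ sphere (0 : E) R := mem_sphere_zero_iff_norm.2 hs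
    rw [← h0 _ hs']
    refine (hg.dist_le_mul _ (ball_subset_closedBall hx) _ (sphere_subset_closedBall hs')).trans ?_
    refine mul_le_mul_of_nonneg_left ?_ K.2
    rw [dist_left_lineMap, Real.norm_eq_abs, abs_of_nonneg ht.1]
    exact mul_le_of_le_one_left dist_nonneg ht.2
  refine LipschitzWith.of_dist_le_mul fun x y => ?_
  by_cases hx : x ∈ ball (0 : E) R <;> by_cases hy : y ∈ ball (0 : E) R
  · rw [indicator_of_mem hx, indicator_of_mem hy]
    exact hg.dist_le_mul _ (ball_subset_closedBall hx) _ (ball_subset_closedBall hy)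
  · rw [indicator_of_mem hx, indicator_of_notMem hy]
    exact key x hx y hy
  · rw [indicator_of_notMem hx, indicator_of_mem hy, dist_comm, dist_comm x y]
    exact key y hy x hx
  · rw [indicator_of_notMem hx, indicator_of_notMem hy, dist_self]
    positivity

variable {E : Type*} [NormedAddCommGroup E] [InnerProductSpace ℝ E] [FiniteDimensional ℝ E]

/-- If the derivative were invertible, some `w` would be sent to `u x`; differentiating the constant
`⟪u, u⟫` along `w` then gives `r ^ 2 = 0`. -/
theorem det_fderiv_eq_zero_of_norm_eq {u : E → E} {r : ℝ} (hr : 0 < r) (hu : Differentiable ℝ u)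
    (hn : ∀ x, ‖u x‖ = r) (x : E) : (fderiv ℝ u x).det = 0 := by
  by_contra hdet
  have hunit : IsUnit (fderiv ℝ u x : E →ₗ[ℝ] E) :=
    (LinearMap.isUnit_iff_isUnit_det _).2 (isUnit_iff_ne_zero.2 hdet)
  obtain ⟨w, hw⟩ := ((Module.End.isUnit_iff _).1 hunit).2 (u x)
  have hconst : (fun y => ⟪u y, u y⟫) = fun _ => r ^ 2 := by
    ext y; rw [real_inner_self_eq_norm_sq, hn]
  have hd := congrArg (fun f => fderiv ℝ f x w) hconst
  simp only [fderiv_inner_apply ℝ (hu x) (hu x)] at hd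
  have hw' : fderiv ℝ u x w = u x := hw
  rw [hw', real_inner_self_eq_norm_sq, hn] at hd
  simp at hd
  exact hr.ne' hd

/-- A form of the Brouwer fixed point theorem. -/
theorem exists_eq_zero_of_eqOn_compl_ball {h : E → E} (hc : Continuous h) {R : ℝ} (hR : 0 < R)
    (hid : ∀ x, R ≤ ‖x‖ → h x = x) : ∃ x, h x = 0 := by
  by_contra! hne
  borelize E
  -- The permitted error at `x` is `‖h x‖`, and the inequality is strict, so the smooth
  -- approximation still has no zero.
  obtain ⟨f, hf, hfh, hfS, -⟩ := hc.exists_contDiff_approx_and_eqOn 1 hc.norm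
    (fun x => norm_pos_iff.2 (hne x)) (S := {x | R + 1 ≤ ‖x‖}) (U := {x | R < ‖x‖})
    (isClosed_le continuous_const continuous_norm)
    ((isOpen_lt continuous_const continuous_norm).mem_nhdsSet.2 fun x hx =>
      lt_of_lt_of_le (lt_add_one R) hx)
    (contDiffOn_id.congr fun x hx => hid x (le_of_lt hx))
  have hf0 : ∀ x, f x ≠ 0 := by
    intro x hx
    have := hfh x
    rw [hx, dist_zero_left] at this
    exact lt_irrefl _ this
  set ρ := R + 1
  have hρ : 0 < ρ := by positivity
  -- A `C¹` map into the sphere of radius `ρ` that fixes this sphere. Its Jacobian vanishes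
  -- identically, while the integral of the Jacobian over the ball is the volume of the ball.
  set u : E → E := fun x => (ρ / ‖f x‖) • f x with hu
  have hu1 : ContDiff ℝ 1 u :=
    (contDiff_const.div (hf.norm ℝ hf0) fun x => norm_ne_zero_iff.2 (hf0 x)).smul hf
  have hun : ∀ x, ‖u x‖ = ρ := by
    intro x
    rw [hu, norm_smul, norm_div, norm_norm, Real.norm_eq_abs, abs_of_pos hρ,
      div_mul_cancel₀ _ (norm_ne_zero_iff.2 (hf0 x))]
  have hus : ∀ x ∈ sphere (0 : E) ρ, u x - x = 0 := by
    intro x hx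
    rw [mem_sphere_zero_iff_norm] at hx
    have : f x = x := by rw [hfS (show ρ ≤ ‖x‖ from hx.ge), hid x (by rw [hx]; simp [ρ])]
    simp [hu, this, hx, div_self hρ.ne']
  have hg1 : ContDiff ℝ 1 fun x => u x - x := hu1.sub contDiff_id
  obtain ⟨K, hK⟩ := (hg1.locallyLipschitz.locallyLipschitzOn
    (s := closedBall 0 ρ)).exists_lipschitzOnWith_of_compact (isCompact_closedBall (0 : E) ρ)
  have hlip := lipschitzWith_indicator_ball hK hus
  have hev : ∀ x ∈ ball (0 : E) ρ,
      (ball (0 : E) ρ).indicator (fun x => u x - x) =ᶠ[𝓝 x] fun x => u x - x := fun x hx =>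
    (eqOn_indicator).eventuallyEq_of_mem (isOpen_ball.mem_nhds hx)
  have hint := integral_det_one_add_fderiv_of_lipschitz Measure.addHaar hlip
    (fun x hx => indicator_of_notMem hx _)
    (fun x hx => ((hev x hx).differentiableAt_iff).2 (hg1.differentiable one_ne_zero x))
  rw [setIntegral_congr_fun (g := fun _ => (0 : ℝ)) measurableSet_ball, integral_zero] at hint
  · have : 0 < (Measure.addHaar : Measure E).real (ball (0 : E) ρ) :=
      ENNReal.toReal_pos (measure_ball_pos _ _ hρ).ne' measure_ball_lt_top.ne
    exact this.ne hint
  · intro x hx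
    dsimp only
    have hux : DifferentiableAt ℝ u x := hu1.differentiable one_ne_zero x
    have : fderiv ℝ ((ball (0 : E) ρ).indicator (fun x => u x - x)) x = fderiv ℝ u x - 1 := by
      rw [(hev x hx).fderiv_eq, fderiv_fun_sub hux differentiableAt_fun_id, fderiv_fun_id]
      rfl
    rw [this, add_sub_cancel]
    exact det_fderiv_eq_zero_of_norm_eq hρ (hu1.differentiable one_ne_zero) hun x

/-- A continuous map of the closed unit ball which moves no point by more than `1` has a zero. -/
theorem exists_eq_zero_of_norm_sub_le_one {h : E → E} (hc : ContinuousOn h (closedBall 0 1))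
    (hid : ∀ x ∈ closedBall (0 : E) 1, ‖h x - x‖ ≤ 1) : ∃ x ∈ closedBall (0 : E) 1, h x = 0 := by
  by_contra! hne
  set π : E → E := fun x => (max 1 ‖x‖)⁻¹ • x with hπ
  have hmax : ∀ x : E, 0 < max 1 ‖x‖ := fun x => lt_max_of_lt_left one_pos
  have hπc : Continuous π :=
    ((continuous_const.max continuous_norm).inv₀ fun x => (hmax x).ne').smul continuous_id
  have hπm : ∀ x, π x ∈ closedBall (0 : E) 1 := by
    intro x
    rw [mem_closedBall_zero_iff, hπ, norm_smul, norm_inv, Real.norm_eq_abs, abs_of_pos (hmax x),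
      inv_mul_le_one₀ (hmax x)]
    exact le_max_right _ _
  set s : E → ℝ := fun x => max 0 (min 1 (2 - ‖x‖)) with hs
  have hsc : Continuous s := by fun_prop
  -- The map is extended by `h ∘ π` and faded linearly into the identity between radii 1 and 2.
  obtain ⟨x, hx⟩ := exists_eq_zero_of_eqOn_compl_ball
    (h := fun x => s x • h (π x) + (1 - s x) • x) (R := 2)
    ((hsc.smul (hc.comp_continuous hπc hπm)).add ((continuous_const.sub hsc).smul continuous_id))
    two_pos (fun x hx => by
      have : s x = 0 := by
        simp only [hs]; exact max_eq_left ((min_le_right _ _).trans (by linarith))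
      simp [this])
  have hs0 : 0 ≤ s x := le_max_left _ _
  have hs1 : s x ≤ 1 := max_le zero_le_one (min_le_left _ _)
  rcases le_or_gt ‖x‖ 1 with h1 | h1
  · have hsx : s x = 1 := by
      simp only [hs]; rw [min_eq_left (by linarith)]; exact max_eq_right zero_le_one
    have hπx : π x = x := by simp [hπ, max_eq_left h1]
    simp only [hsx, hπx, one_smul, sub_self, zero_smul, add_zero] at hx
    exact hne x (by simpa using h1) hx
  · have hxn : 0 < ‖x‖ := by linarith
    have hπx : x = ‖x‖ • π x := by
      simp only [hπ]; rw [max_eq_right h1.le, smul_smul, mul_inv_cancel₀ hxn.ne', one_smul]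
    have hπ1 : ‖π x‖ = 1 := by
      have := congrArg norm hπx
      rw [norm_smul, norm_norm] at this
      exact (mul_eq_left₀ hxn.ne').1 this.symm
    have hs_pos : s x ≠ 0 := by
      intro h0
      simp only [h0, zero_smul, zero_add, sub_zero, one_smul] at hx
      simp [hx] at hxn
    -- A zero outside the unit ball makes `h (π x)` a multiple `-l` of the unit vector `π x` with `l
    -- ≥ 0`. The displacement is then `l + 1`, which is at most 1, so `l = 0` and `π x` is itself a
    -- zero.
    have hlam : h (π x) = -((1 - s x) * ‖x‖ / s x) • π x := by
      have h2 : s x • h (π x) = -(((1 - s x) * ‖x‖) • π x) := by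
        rw [eq_neg_iff_add_eq_zero, mul_smul, ← hπx]; exact hx
      rw [neg_smul, div_eq_inv_mul, mul_smul, ← smul_neg, ← h2, smul_smul, inv_mul_cancel₀ hs_pos,
        one_smul]
    set l := (1 - s x) * ‖x‖ / s x
    have hl : 0 ≤ l := by have : 0 ≤ 1 - s x := by linarith
                          positivity
    have h3 := hid (π x) (hπm x)
    have h4 : h (π x) - π x = -(l + 1) • π x := by rw [hlam]; module
    rw [h4, norm_smul, hπ1, mul_one, norm_neg, Real.norm_eq_abs, abs_of_pos (by positivity)] at h3
    have hl0 : l = 0 := by linarith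
    rw [hl0, neg_zero, zero_smul] at hlam
    exact hne _ (hπm x) hlam

end InvarianceOfDomain

/-! ### Invariance of domain and of dimension -/

section InvarianceOfDomain

open MeasureTheory Set Metric
open scoped NNReal Topology RealInnerProductSpace

/-- Let `G` be a Tietze extension of the inverse of `f`. If `f 0` were not interior, some `c` near
it would lie outside the image, and the image could be pushed radially away from `c` onto a small
sphere. There a perturbation of `G` has no zero, since a smooth image of a sphere is a null set.
Composing yields a map of the ball without zeros that moves points by at most 1, against the fixed
point theorem. -/
theorem mem_interior_image_closedBall {E : Type*} [NormedAddCommGroup E] [InnerProductSpace ℝ E]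
    [FiniteDimensional ℝ E] {f : E → E} (hf : ContinuousOn f (closedBall 0 1))
    (hinj : InjOn f (closedBall 0 1)) : f 0 ∈ interior (f '' closedBall 0 1) := by
  by_contra hint
  borelize E
  set B := closedBall (0 : E) 1 with hB
  have h0B : (0 : E) ∈ B := mem_closedBall_self zero_le_one
  have hBc : IsCompact B := isCompact_closedBall 0 1
  have := isCompact_iff_compactSpace.1 hBc
  obtain ⟨G, hG⟩ : ∃ G : C(E, E), ∀ x ∈ B, G (f x) = x := by
    have he : Topology.IsClosedEmbedding (B.domRestrict f) :=
      (continuousOn_iff_continuous_domRestrict.1 hf).isClosedEmbedding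
        (injOn_iff_injective.1 hinj)
    obtain ⟨G, hG⟩ := ContinuousMap.exists_extension he ⟨((↑) : B → E), continuous_subtype_val⟩
    exact ⟨G, fun x hx => DFunLike.congr_fun hG ⟨x, hx⟩⟩
  have hG0 : G (f 0) = 0 := hG 0 h0B
  obtain ⟨η, hη, hηG⟩ : ∃ η > 0, ∀ y, dist y (f 0) < η → ‖G y‖ < 1 / 10 := by
    obtain ⟨η, hη, h⟩ := Metric.continuousAt_iff.1 (G.continuous.continuousAt (x := f 0))
      (1 / 10) (by norm_num)
    exact ⟨η, hη, fun y hy => by simpa [hG0] using h hy⟩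
  set ε := η / 2 with hε
  have hε0 : 0 < ε := by positivity
  obtain ⟨c, hc, hcf⟩ : ∃ c, dist c (f 0) < ε ∧ c ∉ f '' B := by
    by_contra! h
    exact hint (mem_interior_iff_mem_nhds.2 (Metric.mem_nhds_iff.2 ⟨ε, hε0, fun y hy => h y hy⟩))
  have hcf' : ∀ x ∈ B, 0 < dist (f x) c := fun x hx =>
    dist_pos.2 fun h => hcf ⟨x, hx, h⟩
  have hfB : IsCompact (f '' B) := hBc.image_of_continuousOn hf
  -- On the image of `f`, `G` vanishes only at `f 0`, which is closer to `c` than `ε`; compactness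
  -- gives a uniform lower bound.
  obtain ⟨δ, hδ, hδG⟩ : ∃ δ, 0 < δ ∧ ∀ y ∈ f '' B ∩ {y | ε ≤ dist y c}, δ ≤ ‖G y‖ := by
    refine (hfB.inter_right (isClosed_le continuous_const (by fun_prop))).exists_forall_le'
      G.continuous.norm.continuousOn ?_
    rintro _ ⟨⟨x, hx, rfl⟩, hy⟩
    rw [hG x hx, norm_pos_iff]
    rintro rfl
    rw [mem_ofPred_eq, dist_comm] at hy
    exact absurd hy (not_le.2 hc)
  set δ' := min δ (1 / 10) with hδ'
  have hδ0 : 0 < δ' := lt_min hδ (by norm_num)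
  obtain ⟨P, hP, hPG, -⟩ := G.continuous.exists_contDiff_approx 1
    (continuous_const (y := δ' / 2)) (fun _ => half_pos hδ0)
  have hnull : (Measure.addHaar : Measure E) (P '' sphere c ε) = 0 :=
    addHaar_image_eq_zero_of_differentiableOn_of_addHaar_eq_zero _
      (hP.differentiable one_ne_zero).differentiableOn
      (Measure.addHaar_sphere_of_ne_zero _ _ hε0.ne')
  -- A small translation `P - q` has no zero on the sphere around `c` and stays within `δ'` of `G`.
  obtain ⟨q, hq, hqP⟩ : ∃ q ∈ ball (0 : E) (δ' / 2), q ∉ P '' sphere c ε := by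
    by_contra! h
    exact (measure_ball_pos (Measure.addHaar : Measure E) 0 (half_pos hδ0)).ne'
      (measure_mono_null h hnull)
  have hPq : ∀ y, ‖P y - q - G y‖ < δ' := by
    intro y
    have h1 := hPG y
    rw [dist_eq_norm] at h1
    rw [mem_ball_zero_iff] at hq
    calc ‖P y - q - G y‖ = ‖(P y - G y) - q‖ := by congr 1; abel
      _ ≤ ‖P y - G y‖ + ‖q‖ := norm_sub_le _ _
      _ < δ' := by linarith
  -- Radial push away from `c`: the identity at distance at least `ε`, projection onto the sphere of
  -- radius `ε` otherwise.
  set Φ : E → E := fun y => c + max (ε / dist y c) 1 • (y - c) with hΦ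
  have hΦfar : ∀ y, ε ≤ dist y c → Φ y = y := by
    intro y hy
    have : ε / dist y c ≤ 1 := by
      rw [div_le_one (lt_of_lt_of_le hε0 hy)]; exact hy
    simp [hΦ, max_eq_right this]
  have hΦnear : ∀ y, 0 < dist y c → dist y c < ε → Φ y ∈ sphere c ε := by
    intro y hy0 hy
    have : 1 ≤ ε / dist y c := by rw [one_le_div hy0]; exact hy.le
    rw [mem_sphere_iff_norm]
    simp only [hΦ, max_eq_left this, add_sub_cancel_left]
    rw [norm_smul, ← dist_eq_norm, Real.norm_eq_abs, abs_of_pos (by positivity),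
      div_mul_cancel₀ _ hy0.ne']
  have hΦc : ContinuousOn (fun x => Φ (f x)) B := by
    have hd : ContinuousOn (fun x => dist (f x) c) B := continuous_dist.comp_continuousOn (ContinuousOn.prodMk hf continuousOn_const)
    exact continuousOn_const.add ((ContinuousOn.sup (continuousOn_const.div hd fun x hx =>
      (hcf' x hx).ne') continuousOn_const).smul (ContinuousOn.sub hf continuousOn_const))
  obtain ⟨x, hx, hx0⟩ := exists_eq_zero_of_norm_sub_le_one (h := fun x => P (Φ (f x)) - q)
    ((hP.continuous.comp_continuousOn hΦc).sub continuousOn_const) (fun x hx => by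
      have hxG := hG x hx
      rcases le_or_gt ε (dist (f x) c) with h | h
      · rw [hΦfar _ h]
        have := hPq (f x)
        rw [hxG] at this
        exact this.le.trans ((min_le_right _ _).trans (by norm_num))
      · have hs := hΦnear _ (hcf' x hx) h
        have h1 : ‖G (Φ (f x))‖ < 1 / 10 := hηG _ (by
          have := dist_triangle (Φ (f x)) c (f 0)
          rw [mem_sphere.1 hs] at this
          linarith)
        have h2 : ‖x‖ < 1 / 10 := by
          rw [← hxG]
          refine hηG _ ?_
          have := dist_triangle (f x) c (f 0)
          linarith
        have h3 := hPq (Φ (f x))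
        have h4 : δ' ≤ 1 / 10 := min_le_right _ _
        calc ‖P (Φ (f x)) - q - x‖
            = ‖(P (Φ (f x)) - q - G (Φ (f x))) + (G (Φ (f x)) - x)‖ := by congr 1; abel
          _ ≤ ‖P (Φ (f x)) - q - G (Φ (f x))‖ + (‖G (Φ (f x))‖ + ‖x‖) :=
            (norm_add_le _ _).trans (add_le_add_right (norm_sub_le _ _) _)
          _ ≤ 1 := by linarith)
  rcases le_or_gt ε (dist (f x) c) with h | h
  · have h1 := hPq (f x)
    rw [hΦfar _ h] at hx0
    rw [hx0, zero_sub, norm_neg] at h1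
    have := hδG (f x) ⟨mem_image_of_mem _ hx, h⟩
    exact absurd (h1.trans_le (min_le_left _ _)) (not_lt.2 this)
  · exact hqP ⟨_, hΦnear _ (hcf' x hx) h, sub_eq_zero.1 hx0⟩

theorem isOpen_image_of_injOn_of_inner {E : Type*} [NormedAddCommGroup E] [InnerProductSpace ℝ E]
    [FiniteDimensional ℝ E] {f : E → E} {U : Set E} (hU : IsOpen U) (hf : ContinuousOn f U)
    (hinj : InjOn f U) : IsOpen (f '' U) := by
  rw [isOpen_iff_mem_nhds]
  rintro _ ⟨x, hx, rfl⟩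
  obtain ⟨r, hr, hrU⟩ := Metric.nhds_basis_closedBall.mem_iff.1 (hU.mem_nhds hx)
  set T : E → E := fun y => x + r • y with hT
  have hTm : MapsTo T (closedBall 0 1) U := by
    intro y hy
    refine hrU ?_
    rw [mem_closedBall_iff_norm, hT]
    simp only [add_sub_cancel_left]
    rw [norm_smul, Real.norm_eq_abs, abs_of_pos hr]
    exact mul_le_of_le_one_right hr.le (mem_closedBall_zero_iff.1 hy)
  have hTi : Function.Injective T := fun y z h =>
    smul_right_injective E hr.ne' (add_left_cancel h)
  have hTc : Continuous T := by fun_prop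
  have := mem_interior_image_closedBall (f := f ∘ T) (hf.comp hTc.continuousOn hTm)
    (hinj.comp hTi.injOn hTm)
  rw [Function.comp_apply, show T 0 = x by simp [hT], mem_interior_iff_mem_nhds] at this
  refine Filter.mem_of_superset this ?_
  rw [image_comp]
  exact image_mono hTm.image_subset

/-- **Invariance of domain.** -/
theorem isOpen_image_of_injOn {E F : Type*} [NormedAddCommGroup E] [NormedSpace ℝ E]
    [FiniteDimensional ℝ E] [NormedAddCommGroup F] [NormedSpace ℝ F] [FiniteDimensional ℝ F]
    (hEF : Module.finrank ℝ E = Module.finrank ℝ F) {f : E → F} {U : Set E} (hU : IsOpen U)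
    (hf : ContinuousOn f U) (hinj : InjOn f U) : IsOpen (f '' U) := by
  let e : E ≃L[ℝ] EuclideanSpace ℝ (Fin (Module.finrank ℝ E)) :=
    ContinuousLinearEquiv.ofFinrankEq (by simp)
  let e' : F ≃L[ℝ] EuclideanSpace ℝ (Fin (Module.finrank ℝ E)) :=
    ContinuousLinearEquiv.ofFinrankEq (by simp [hEF])
  have := isOpen_image_of_injOn_of_inner (f := e' ∘ f ∘ e.symm) (U := e '' U)
    (e.toHomeomorph.isOpenMap _ hU)
    (e'.continuous.comp_continuousOn (hf.comp e.symm.continuous.continuousOn (by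
      rintro _ ⟨x, hx, rfl⟩; simpa using hx)))
    (e'.injective.comp_injOn (hinj.comp e.symm.injective.injOn (by
      rintro _ ⟨x, hx, rfl⟩; simpa using hx)))
  rw [← image_comp, Function.comp_assoc, Function.comp_assoc,
    show (e.symm : _ → E) ∘ e = id from funext fun x => by simp, Function.comp_id,
    image_comp] at this
  exact (e'.toHomeomorph.isOpen_image).1 this

/-- **Invariance of dimension.** -/
theorem not_injOn_of_finrank_lt {E F : Type*} [NormedAddCommGroup E] [NormedSpace ℝ E]
    [FiniteDimensional ℝ E] [NormedAddCommGroup F] [NormedSpace ℝ F] [FiniteDimensional ℝ F]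
    (hEF : Module.finrank ℝ F < Module.finrank ℝ E) {f : E → F} {U : Set E} (hU : IsOpen U)
    (hne : U.Nonempty) (hf : ContinuousOn f U) : ¬ InjOn f U := by
  intro hinj
  -- Composing with a linear embedding of `F` into `E` gives an open set inside a proper subspace.
  obtain ⟨L, hL⟩ := Module.Free.exists_linearMap_injective_of_lift_rank_lt (R := ℝ) (M := F) (N' := E)
    (by
      rw [← Module.finrank_eq_rank, ← Module.finrank_eq_rank, Cardinal.lift_natCast,
        Cardinal.lift_natCast]
      exact_mod_cast hEF)
  have hopen := isOpen_image_of_injOn (f := L ∘ f) rfl hU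
    (L.continuous_of_finiteDimensional.comp_continuousOn hf) (hL.comp_injOn hinj)
  have htop : L.range = ⊤ := by
    refine Submodule.eq_top_of_nonempty_interior' _ ?_
    obtain ⟨x, hx⟩ := hne
    refine ⟨L (f x), mem_interior.2 ⟨_, ?_, hopen, mem_image_of_mem _ hx⟩⟩
    rintro _ ⟨y, -, rfl⟩
    exact ⟨f y, rfl⟩
  have := LinearMap.finrank_range_of_inj hL
  rw [htop, finrank_top] at this
  omega

end InvarianceOfDomain

/-! ### Radial extensions and unit spheres of normed spaces -/

section Homogeneous

open Set Metric
open scoped Topology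

/-- The degree-one homogeneous extension of a bounded map. Boundedness gives continuity where `N`
vanishes; the junk value of `(N x)⁻¹` there is multiplied by zero. -/
theorem continuousOn_homogeneous {X Y : Type*} [NormedAddCommGroup X] [NormedSpace ℝ X]
    [NormedAddCommGroup Y] [NormedSpace ℝ Y] {S T : Set X} {N : X → ℝ} {H : X → Y}
    (hN : ContinuousOn N S) (hH : ContinuousOn H T) (hb : ∀ t ∈ T, ‖H t‖ ≤ 1)
    (hT : ∀ x ∈ S, N x ≠ 0 → (N x)⁻¹ • x ∈ T) :
    ContinuousOn (fun x => N x • H ((N x)⁻¹ • x)) S := by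
  intro x hx
  by_cases h0 : N x = 0
  · have hNx : Filter.Tendsto (fun y => |N y|) (𝓝[S] x) (𝓝 0) := by
      have := (hN x hx).abs
      rwa [ContinuousWithinAt, h0, abs_zero] at this
    rw [ContinuousWithinAt, h0, zero_smul]
    refine squeeze_zero_norm' ?_ hNx
    filter_upwards [self_mem_nhdsWithin] with y hy
    rw [norm_smul, Real.norm_eq_abs]
    by_cases hy0 : N y = 0
    · simp [hy0]
    · exact mul_le_of_le_one_right (abs_nonneg _) (hb _ (hT y hy hy0))
  · have hev : ∀ᶠ y in 𝓝[S] x, N y ≠ 0 := (hN x hx).eventually_ne h0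
    have hmaps : ∀ᶠ y in 𝓝[S] x, (N y)⁻¹ • y ∈ T := by
      filter_upwards [hev, self_mem_nhdsWithin] with y hy hyS using hT y hyS hy
    have hinner : Filter.Tendsto (fun y => (N y)⁻¹ • y) (𝓝[S] x) (𝓝[T] ((N x)⁻¹ • x)) :=
      tendsto_nhdsWithin_iff.2 ⟨((hN x hx).inv₀ h0).smul continuousWithinAt_id, hmaps⟩
    exact (hN x hx).smul ((hH _ (hT x hx h0)).tendsto.comp hinner)

theorem inv_norm_smul_mem_sphere {E : Type*} [NormedAddCommGroup E] [NormedSpace ℝ E] {x : E}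
    (hx : x ≠ 0) : ‖x‖⁻¹ • x ∈ sphere (0 : E) 1 := by
  rw [mem_sphere_zero_iff_norm, norm_smul, norm_inv, norm_norm,
    inv_mul_cancel₀ (norm_ne_zero_iff.2 hx)]

/-- The unit spheres of two normed spaces of the same finite dimension are homeomorphic. -/
theorem nonempty_homeomorph_sphere_of_finrank_eq {E F : Type*} [NormedAddCommGroup E]
    [NormedSpace ℝ E] [FiniteDimensional ℝ E] [NormedAddCommGroup F] [NormedSpace ℝ F]
    [FiniteDimensional ℝ F] (h : Module.finrank ℝ E = Module.finrank ℝ F) :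
    Nonempty (sphere (0 : E) 1 ≃ₜ sphere (0 : F) 1) := by
  let e : E ≃L[ℝ] F := ContinuousLinearEquiv.ofFinrankEq h
  have hne : ∀ x : sphere (0 : E) 1, e x ≠ 0 := fun x hx =>
    ne_zero_of_mem_unit_sphere x (by simpa using hx)
  have hne' : ∀ y : sphere (0 : F) 1, e.symm y ≠ 0 := fun y hy =>
    ne_zero_of_mem_unit_sphere y (by simpa using hy)
  refine ⟨{ toFun := fun x => ⟨‖e x‖⁻¹ • e x, inv_norm_smul_mem_sphere (hne x)⟩
            invFun := fun y => ⟨‖e.symm y‖⁻¹ • e.symm y, inv_norm_smul_mem_sphere (hne' y)⟩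
            left_inv := fun x => ?_
            right_inv := fun y => ?_
            continuous_toFun := ?_
            continuous_invFun := ?_ }⟩
  · ext1
    have h1 := norm_ne_zero_iff.2 (hne x)
    have h2 : ‖(x : E)‖ = 1 := norm_eq_of_mem_sphere x
    simp only [map_smul, ContinuousLinearEquiv.symm_apply_apply, norm_smul, norm_inv, norm_norm,
      h2, mul_one, inv_inv, smul_smul, mul_inv_cancel₀ h1, one_smul]
  · ext1
    have h1 := norm_ne_zero_iff.2 (hne' y)
    have h2 : ‖(y : F)‖ = 1 := norm_eq_of_mem_sphere y
    simp only [map_smul, ContinuousLinearEquiv.apply_symm_apply, norm_smul, norm_inv, norm_norm,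
      h2, mul_one, inv_inv, smul_smul, mul_inv_cancel₀ h1, one_smul]
  · have hc : Continuous fun x : sphere (0 : E) 1 => e x := e.continuous.comp continuous_subtype_val
    exact ((hc.norm.inv₀ fun x => norm_ne_zero_iff.2 (hne x)).smul hc).subtype_mk _
  · have hc : Continuous fun y : sphere (0 : F) 1 => e.symm y :=
      e.symm.continuous.comp continuous_subtype_val
    exact ((hc.norm.inv₀ fun y => norm_ne_zero_iff.2 (hne' y)).smul hc).subtype_mk _

end Homogeneous

/-! ### Cones over realizations, and joins of spheres -/

namespace FlagSphere

open Set Metric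
open scoped Topology

theorem IsFace.mono {V : Type*} {K : PreAbstractSimplicialComplex V} {F G : Finset V}
    (hF : IsFace K F) (h : G ⊆ F) : IsFace K G := by
  rcases G.eq_empty_or_nonempty with hG | hG
  · exact Or.inl hG
  · rcases hF with rfl | hF
    · exact Or.inl (Finset.subset_empty.1 h)
    · exact Or.inr ((K.isRelLowerSet_faces hF).2 h hG)

theorem nonempty_of_mem {V : Type*} {K : PreAbstractSimplicialComplex V} {F : Finset V}
    (hF : F ∈ K) : F.Nonempty := (K.isRelLowerSet_faces hF).1

theorem mem_iff_isFace {V : Type*} {K : PreAbstractSimplicialComplex V} {F : Finset V} :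
    F ∈ K ↔ F.Nonempty ∧ IsFace K F :=
  ⟨fun h => ⟨nonempty_of_mem h, Or.inr h⟩, fun h => h.2.resolve_left h.1.ne_empty⟩

theorem ext_isFace {V : Type*} {K L : PreAbstractSimplicialComplex V}
    (h : ∀ s, IsFace K s ↔ IsFace L s) : K = L :=
  SetLike.ext fun s => by rw [mem_iff_isFace, mem_iff_isFace, h]

/-- The cone `{t • w : t ≥ 0, w ∈ |K|}` over the geometric realization. -/
def coneSet {V : Type*} [Fintype V] (K : PreAbstractSimplicialComplex V) : Set (V → ℝ) :=
  {w | (∀ p, 0 ≤ w p) ∧ IsFace K (Finset.univ.filter fun p => w p ≠ 0)}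

theorem mem_realization_iff {V : Type*} [Fintype V] {K : PreAbstractSimplicialComplex V}
    {w : V → ℝ} : w ∈ realization K ↔ w ∈ coneSet K ∧ ∑ p, w p = 1 := by
  constructor
  · rintro ⟨h0, h1, s, hs, hws⟩
    exact ⟨⟨h0, IsFace.mono (Or.inr hs) fun p hp => hws p (Finset.mem_filter.1 hp).2⟩, h1⟩
  · rintro ⟨⟨h0, hs⟩, h1⟩
    refine ⟨h0, h1, _, hs.resolve_left fun h => ?_, fun p hp => by simpa using hp⟩
    have : ∑ p, w p = 0 := Finset.sum_eq_zero fun p _ => by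
      by_contra hp
      have : p ∈ Finset.univ.filter fun p => w p ≠ 0 := by simpa using hp
      simp [h] at this
    exact zero_ne_one (this.symm.trans h1)

theorem smul_mem_coneSet {V : Type*} [Fintype V] {K : PreAbstractSimplicialComplex V}
    {w : V → ℝ} (hw : w ∈ coneSet K) {t : ℝ} (ht : 0 ≤ t) : t • w ∈ coneSet K := by
  refine ⟨fun p => mul_nonneg ht (hw.1 p), hw.2.mono fun p hp => ?_⟩
  simp only [Finset.mem_filter, Finset.mem_univ, true_and, Pi.smul_apply, smul_eq_mul] at hp ⊢
  exact right_ne_zero_of_mul hp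

/-- The cone over `|K|` is homeomorphic to the normed space `E`, in such a way that the sum of the
barycentric coordinates corresponds to the norm. -/
def ConeHomeo {V : Type*} [Fintype V] (K : PreAbstractSimplicialComplex V) (E : Type*)
    [NormedAddCommGroup E] : Prop :=
  ∃ (Φ : (V → ℝ) → E) (Ψ : E → V → ℝ), ContinuousOn Φ (coneSet K) ∧ Continuous Ψ ∧
    (∀ u, Ψ u ∈ coneSet K) ∧ (∀ w ∈ coneSet K, Ψ (Φ w) = w) ∧ (∀ u, Φ (Ψ u) = u) ∧
    ∀ w ∈ coneSet K, ‖Φ w‖ = ∑ p, w p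

theorem norm_le_one_of_mem_realization {V : Type*} [Fintype V]
    {K : PreAbstractSimplicialComplex V} {w : V → ℝ} (hw : w ∈ realization K) : ‖w‖ ≤ 1 := by
  rw [pi_norm_le_iff_of_nonneg zero_le_one]
  intro p
  rw [Real.norm_eq_abs, abs_of_nonneg (hw.1 p), ← hw.2.1]
  exact Finset.single_le_sum (f := w) (fun q _ => hw.1 q) (Finset.mem_univ p)

/-- Both maps are extended homogeneously, using the coordinate sum as radius on the cone and the
norm as radius on `E`. -/
theorem coneHomeo_of_homeomorph_sphere {V : Type*} [Fintype V]
    {K : PreAbstractSimplicialComplex V} {E : Type*} [NormedAddCommGroup E] [NormedSpace ℝ E]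
    (h : realization K ≃ₜ sphere (0 : E) 1) : ConeHomeo K E := by
  classical
  set H : (V → ℝ) → E := fun w => if hw : w ∈ realization K then h ⟨w, hw⟩ else 0 with hH
  set G : E → V → ℝ := fun u => if hu : u ∈ sphere (0 : E) 1 then h.symm ⟨u, hu⟩ else 0 with hG
  have hHc : ContinuousOn H (realization K) := by
    rw [continuousOn_iff_continuous_domRestrict]
    have : (realization K).domRestrict H = fun w => (h w : E) := by
      ext w; simp [hH]
    rw [this]
    exact continuous_subtype_val.comp h.continuous
  have hGc : ContinuousOn G (sphere (0 : E) 1) := by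
    rw [continuousOn_iff_continuous_domRestrict]
    have : (sphere (0 : E) 1).domRestrict G = fun u => (h.symm u : V → ℝ) := by
      ext1 u
      rw [domRestrict_apply, hG]
      simp only
      rw [dif_pos u.2]
    rw [this]
    exact continuous_subtype_val.comp h.symm.continuous
  have hHm : ∀ w ∈ realization K, ‖H w‖ = 1 ∧ G (H w) = w := by
    intro w hw
    have h1 : H w = h ⟨w, hw⟩ := by simp only [hH]; rw [dif_pos hw]
    rw [h1]
    refine ⟨norm_eq_of_mem_sphere _, ?_⟩
    simp only [hG]
    rw [dif_pos (h ⟨w, hw⟩).2]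
    simp
  have hGm : ∀ u ∈ sphere (0 : E) 1, G u ∈ realization K ∧ H (G u) = u := by
    intro u hu
    have h1 : G u = h.symm ⟨u, hu⟩ := by simp only [hG]; rw [dif_pos hu]
    rw [h1]
    refine ⟨(h.symm ⟨u, hu⟩).2, ?_⟩
    simp only [hH]
    rw [dif_pos (h.symm ⟨u, hu⟩).2]
    simp
  have hK1 : ∀ w ∈ coneSet K, ∑ p, w p ≠ 0 → (∑ p, w p)⁻¹ • w ∈ realization K := by
    intro w hw h0
    refine mem_realization_iff.2
      ⟨smul_mem_coneSet hw (inv_nonneg.2 (Finset.sum_nonneg fun p _ => hw.1 p)), ?_⟩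
    simp only [Pi.smul_apply, smul_eq_mul]
    rw [← Finset.mul_sum, inv_mul_cancel₀ h0]
  have hS1 : ∀ u : E, ‖u‖ ≠ 0 → ‖u‖⁻¹ • u ∈ sphere (0 : E) 1 := fun u hu =>
    inv_norm_smul_mem_sphere (norm_ne_zero_iff.1 hu)
  have hzero : ∀ w ∈ coneSet K, ∑ p, w p = 0 → w = 0 := by
    intro w hw h0
    ext p
    exact (Finset.sum_eq_zero_iff_of_nonneg fun q _ => hw.1 q).1 h0 p (Finset.mem_univ p)
  have hnorm : ∀ w ∈ coneSet K, ‖(∑ p, w p) • H ((∑ p, w p)⁻¹ • w)‖ = ∑ p, w p := by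
    intro w hw
    rw [norm_smul, Real.norm_eq_abs, abs_of_nonneg (Finset.sum_nonneg fun p _ => hw.1 p)]
    by_cases h0 : ∑ p, w p = 0
    · simp [h0]
    · rw [(hHm _ (hK1 w hw h0)).1, mul_one]
  refine ⟨fun w => (∑ p, w p) • H ((∑ p, w p)⁻¹ • w), fun u => ‖u‖ • G (‖u‖⁻¹ • u), ?_, ?_, ?_,
    ?_, ?_, hnorm⟩
  · exact continuousOn_homogeneous (by fun_prop) hHc (fun w hw => (hHm w hw).1.le) hK1
  · rw [← continuousOn_univ]
    exact continuousOn_homogeneous continuous_norm.continuousOn hGc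
      (fun u hu => norm_le_one_of_mem_realization (hGm u hu).1) (fun u _ => hS1 u)
  · intro u
    by_cases hu : ‖u‖ = 0
    · dsimp only
      rw [hu, zero_smul]
      exact ⟨fun p => le_rfl, Or.inl (by simp)⟩
    · exact smul_mem_coneSet (mem_realization_iff.1 (hGm _ (hS1 u hu)).1).1 (norm_nonneg u)
  · intro w hw
    dsimp only
    rw [hnorm w hw]
    by_cases h0 : ∑ p, w p = 0
    · rw [h0, zero_smul, hzero w hw h0]
    · rw [smul_smul, inv_mul_cancel₀ h0, one_smul, (hHm _ (hK1 w hw h0)).2, smul_smul,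
        mul_inv_cancel₀ h0, one_smul]
  · intro u
    dsimp only
    by_cases hu : ‖u‖ = 0
    · simp [norm_eq_zero.1 hu]
    · have hG1 := hGm _ (hS1 u hu)
      have hs : ∑ p, (‖u‖ • G (‖u‖⁻¹ • u)) p = ‖u‖ := by
        simp only [Pi.smul_apply, smul_eq_mul]
        rw [← Finset.mul_sum, hG1.1.2.1, mul_one]
      rw [hs, smul_smul, inv_mul_cancel₀ hu, one_smul, hG1.2, smul_smul, mul_inv_cancel₀ hu,
        one_smul]

theorem ConeHomeo.nonempty_homeomorph_sphere {V : Type*} [Fintype V]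
    {K : PreAbstractSimplicialComplex V} {E : Type*} [NormedAddCommGroup E] (h : ConeHomeo K E) :
    Nonempty (realization K ≃ₜ sphere (0 : E) 1) := by
  obtain ⟨Φ, Ψ, hΦ, hΨ, hmem, hl, hr, hn⟩ := h
  have hsub : realization K ⊆ coneSet K := fun w hw => (mem_realization_iff.1 hw).1
  have h1 : ∀ w ∈ realization K, Φ w ∈ sphere (0 : E) 1 := fun w hw => by
    rw [mem_sphere_zero_iff_norm, hn w (hsub hw), hw.2.1]
  have h2 : ∀ u ∈ sphere (0 : E) 1, Ψ u ∈ realization K := fun u hu => by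
    refine mem_realization_iff.2 ⟨hmem u, ?_⟩
    rw [← hn _ (hmem u), hr, mem_sphere_zero_iff_norm.1 hu]
  exact ⟨{ toFun := fun w => ⟨Φ w, h1 w w.2⟩
           invFun := fun u => ⟨Ψ u, h2 u u.2⟩
           left_inv := fun w => Subtype.ext (hl w (hsub w.2))
           right_inv := fun u => Subtype.ext (hr u)
           continuous_toFun :=
             (continuousOn_iff_continuous_domRestrict.1 (hΦ.mono hsub)).subtype_mk _
           continuous_invFun := (hΨ.comp continuous_subtype_val).subtype_mk _ }⟩

/-- The part `{p : (i, p) ∈ s}` of `s` in the `i`-th copy of `V`. -/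
def slice {ι V : Type*} [DecidableEq ι] [DecidableEq V] (s : Finset (ι × V)) (i : ι) : Finset V :=
  (s.filter fun q => q.1 = i).image Prod.snd

@[simp]
theorem mem_slice {ι V : Type*} [DecidableEq ι] [DecidableEq V] {s : Finset (ι × V)} {i : ι}
    {p : V} : p ∈ slice s i ↔ (i, p) ∈ s := by
  simp [slice]

theorem isFace_map_iff {V W : Type*} [DecidableEq W] {K : PreAbstractSimplicialComplex V}
    {f : V → W} {s : Finset W} : IsFace (K.map f) s ↔ ∃ t, IsFace K t ∧ s = t.image f := by
  constructor
  · rintro (rfl | ⟨t, ht, rfl⟩)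
    · exact ⟨∅, Or.inl rfl, rfl⟩
    · exact ⟨t, Or.inr ht, rfl⟩
  · rintro ⟨t, rfl | ht, rfl⟩
    · exact Or.inl rfl
    · exact Or.inr ⟨t, ht, rfl⟩

theorem isFace_iJoin_iff {ι V : Type*} [Fintype ι] [DecidableEq V]
    {K : ι → PreAbstractSimplicialComplex V} {s : Finset V} :
    IsFace (iJoin K) s ↔
      ∃ F : ι → Finset V, (∀ i, IsFace (K i) (F i)) ∧ s = Finset.univ.biUnion F := by
  constructor
  · rintro (rfl | ⟨-, h⟩)
    · exact ⟨fun _ => ∅, fun _ => Or.inl rfl, by ext; simp⟩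
    · exact h
  · intro h
    rcases s.eq_empty_or_nonempty with hs | hs
    · exact Or.inl hs
    · exact Or.inr ⟨hs, h⟩

theorem isFace_joinPower_iff {V : Type*} [DecidableEq V] {k : ℕ}
    {K : PreAbstractSimplicialComplex V} {s : Finset (Fin k × V)} :
    IsFace (joinPower k K) s ↔ ∀ i, IsFace K (slice s i) := by
  rw [joinPower, isFace_iJoin_iff]
  constructor
  · rintro ⟨F, hF, rfl⟩ i
    obtain ⟨t, ht, hti⟩ := isFace_map_iff.1 (hF i)
    refine ht.mono fun p hp => ?_
    simp only [mem_slice, Finset.mem_biUnion, Finset.mem_univ, true_and] at hp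
    obtain ⟨j, hj⟩ := hp
    obtain ⟨t', -, htj⟩ := isFace_map_iff.1 (hF j)
    obtain rfl : j = i := by
      rw [htj, Finset.mem_image] at hj
      obtain ⟨q, -, hq⟩ := hj
      exact congrArg Prod.fst hq
    rw [hti, Finset.mem_image] at hj
    obtain ⟨q, hq, hqp⟩ := hj
    obtain rfl : q = p := congrArg Prod.snd hqp
    exact hq
  · intro h
    refine ⟨fun i => (slice s i).image fun p => (i, p), fun i =>
      isFace_map_iff.2 ⟨_, h i, rfl⟩, ?_⟩
    ext ⟨i, p⟩
    simp

/-- This is the reason for working with cones: the cone over a join is the product of the cones,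
with no normalization to distribute among the factors. -/
theorem mem_coneSet_joinPower_iff {V : Type*} [Fintype V] [DecidableEq V] {k : ℕ}
    {K : PreAbstractSimplicialComplex V} {w : Fin k × V → ℝ} :
    w ∈ coneSet (joinPower k K) ↔ ∀ i, (fun p => w (i, p)) ∈ coneSet K := by
  have hs : ∀ i, slice (Finset.univ.filter fun q => w q ≠ 0) i =
      Finset.univ.filter fun p => w (i, p) ≠ 0 := fun i => by ext p; simp
  constructor
  · rintro ⟨h0, hf⟩ i
    refine ⟨fun p => h0 _, ?_⟩
    rw [← hs]
    exact isFace_joinPower_iff.1 hf i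
  · intro h
    refine ⟨fun q => (h q.1).1 q.2, isFace_joinPower_iff.2 fun i => ?_⟩
    rw [hs]
    exact (h i).2

/-- Coordinate sums add up over the copies, so the product must carry the `ℓ¹` norm. -/
theorem ConeHomeo.joinPower {V : Type*} [Fintype V] [DecidableEq V]
    {K : PreAbstractSimplicialComplex V} {E : Type*} [NormedAddCommGroup E] (h : ConeHomeo K E)
    (k : ℕ) : ConeHomeo (joinPower k K) (PiLp 1 fun _ : Fin k => E) := by
  obtain ⟨Φ, Ψ, hΦ, hΨ, hmem, hl, hr, hn⟩ := h
  refine ⟨fun w => WithLp.toLp 1 fun i => Φ fun p => w (i, p), fun u q => Ψ (u q.1) q.2,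
    ?_, ?_, ?_, ?_, ?_, ?_⟩
  · refine (PiLp.continuous_toLp 1 _).comp_continuousOn (continuousOn_pi.2 fun i => ?_)
    exact hΦ.comp (by fun_prop) fun w hw => mem_coneSet_joinPower_iff.1 hw i
  · refine continuous_pi fun q => ?_
    exact (continuous_apply q.2).comp (hΨ.comp (by fun_prop))
  · exact fun u => mem_coneSet_joinPower_iff.2 fun i => hmem (u i)
  · intro w hw
    ext ⟨i, p⟩
    exact congrFun (hl _ (mem_coneSet_joinPower_iff.1 hw i)) p
  · intro u
    ext i
    exact hr (u i)
  · intro w hw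
    rw [PiLp.norm_eq_of_L1, Fintype.sum_prod_type]
    exact Finset.sum_congr rfl fun i _ => hn _ (mem_coneSet_joinPower_iff.1 hw i)

theorem IsSimplicialSphere.joinPower {V : Type*} [Fintype V] [DecidableEq V] {d : ℕ}
    {K : PreAbstractSimplicialComplex V} (h : IsSimplicialSphere d K) {k : ℕ} (hk : 1 ≤ k) :
    IsSimplicialSphere ((d + 1) * k - 1) (joinPower k K) := by
  obtain ⟨e⟩ := h
  obtain ⟨e1⟩ := ((coneHomeo_of_homeomorph_sphere e).joinPower k).nonempty_homeomorph_sphere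
  have hpos : 1 ≤ (d + 1) * k := Nat.mul_pos (Nat.succ_pos d) hk
  obtain ⟨e2⟩ := nonempty_homeomorph_sphere_of_finrank_eq
    (E := PiLp 1 fun _ : Fin k => EuclideanSpace ℝ (Fin (d + 1)))
    (F := EuclideanSpace ℝ (Fin ((d + 1) * k - 1 + 1))) (by
      rw [finrank_euclideanSpace_fin, (WithLp.linearEquiv 1 ℝ _).finrank_eq, Module.finrank_pi_fintype]
      simp only [finrank_euclideanSpace_fin, Finset.sum_const, Finset.card_univ, Fintype.card_fin,
        smul_eq_mul]
      rw [mul_comm]; omega)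
  exact ⟨e1.trans e2⟩

end FlagSphere

/-! ### Triangulated spheres are closed pseudomanifolds -/

namespace FlagSphere

open Set Metric
open scoped Topology

/-- Extension by zero of a weight on the vertex set `s`. -/
noncomputable def extendZero {V : Type*} (s : Finset V) (u : s → ℝ) : V → ℝ :=
  open Classical in fun p => if h : p ∈ s then u ⟨p, h⟩ else 0

theorem extendZero_apply_of_mem {V : Type*} {s : Finset V} (u : s → ℝ) (p : s) :
    extendZero s u p = u p := by simp [extendZero]

theorem extendZero_apply_of_notMem {V : Type*} {s : Finset V} (u : s → ℝ) {p : V} (hp : p ∉ s) :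
    extendZero s u p = 0 := by simp [extendZero, hp]

theorem continuous_extendZero {V : Type*} (s : Finset V) : Continuous (extendZero s) := by
  refine continuous_pi fun p => ?_
  by_cases hp : p ∈ s
  · simpa [extendZero, hp] using continuous_apply (⟨p, hp⟩ : s)
  · simpa [extendZero, hp] using continuous_const

theorem isOpen_setOf_forall_pos {ι : Type*} [Finite ι] : IsOpen {u : ι → ℝ | ∀ i, 0 < u i} := by
  simp only [ofPred_forall]
  exact isOpen_iInter_of_finite fun i => isOpen_lt continuous_const (continuous_apply i)

theorem isOpen_openStar {V E : Type*} [TopologicalSpace E] {Ψ : E → V → ℝ} (hΨ : Continuous Ψ) (s : Finset V) :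
    IsOpen {u | ∀ p ∈ s, 0 < Ψ u p} := by
  have : {u | ∀ p ∈ s, 0 < Ψ u p} = ⋂ p ∈ s, {u | 0 < Ψ u p} := by ext; simp
  rw [this]
  exact isOpen_biInter_finset fun p _ =>
    isOpen_lt continuous_const ((continuous_apply p).comp hΨ)

section Cone

variable {V : Type*} [Fintype V] [DecidableEq V] {K : PreAbstractSimplicialComplex V}

theorem extendZero_mem_coneSet {s : Finset V} (hs : IsFace K s) {u : s → ℝ} (hu : ∀ i, 0 ≤ u i) :
    extendZero s u ∈ coneSet K := by
  refine ⟨fun p => ?_, hs.mono fun p hp => ?_⟩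
  · by_cases hp : p ∈ s
    · exact (extendZero_apply_of_mem u ⟨p, hp⟩).symm ▸ hu _
    · rw [extendZero_apply_of_notMem u hp]
  · by_contra h
    exact (Finset.mem_filter.1 hp).2 (extendZero_apply_of_notMem u h)

theorem isFace_insert_of_mem_coneSet {w : V → ℝ} (hw : w ∈ coneSet K) {s : Finset V}
    (hs : ∀ p ∈ s, 0 < w p) {q : V} (hq : w q ≠ 0) : IsFace K (insert q s) := by
  refine hw.2.mono fun p hp => Finset.mem_filter.2 ⟨Finset.mem_univ p, ?_⟩
  rcases Finset.mem_insert.1 hp with rfl | hp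
  · exact hq
  · exact (hs p hp).ne'

variable {E : Type*} [NormedAddCommGroup E] [NormedSpace ℝ E] [FiniteDimensional ℝ E]

/-- If the cone over `|K|` is an `n`-dimensional space, then every facet of `K` has `n`
vertices. -/
theorem ConeHomeo.card_of_maximal (h : ConeHomeo K E) {s : Finset V} (hs : IsFace K s)
    (hmax : ∀ p ∉ s, ¬ IsFace K (insert p s)) : s.card = Module.finrank ℝ E := by
  obtain ⟨Φ, Ψ, hΦ, hΨ, hmem, hl, hr, -⟩ := h
  have hfin : Module.finrank ℝ (s → ℝ) = s.card := by simp
  rcases lt_trichotomy s.card (Module.finrank ℝ E) with hlt | heq | hgt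
  · exfalso
    have hone := extendZero_mem_coneSet hs (u := fun _ => 1) fun _ => zero_le_one
    -- Too few vertices: on the open star of a maximal face the other coordinates vanish, so the
    -- coordinates in `s` embed an open subset of `E` into a space of smaller dimension.
    refine not_injOn_of_finrank_lt (f := fun u (p : s) => Ψ u p) (hfin.trans_lt hlt)
      (isOpen_openStar hΨ s) ⟨Φ (extendZero s fun _ => 1), fun p hp => ?_⟩
      (by fun_prop) fun u hu u' hu' huu => ?_
    · rw [hl _ hone, extendZero_apply_of_mem _ ⟨p, hp⟩]; exact one_pos
    · have hz : ∀ u ∈ {u | ∀ p ∈ s, 0 < Ψ u p}, ∀ p ∉ s, Ψ u p = 0 := by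
        intro u hu p hp
        by_contra hne
        exact hmax p hp (isFace_insert_of_mem_coneSet (hmem u) hu hne)
      rw [← hr u, ← hr u']
      congr 1
      ext p
      by_cases hp : p ∈ s
      · exact congrFun huu ⟨p, hp⟩
      · rw [hz u hu p hp, hz u' hu' p hp]
  · exact heq
  · exfalso
    have hmaps : MapsTo (extendZero s) {u | ∀ i, 0 < u i} (coneSet K) := fun u hu =>
      extendZero_mem_coneSet hs fun i => (hu i).le
    -- Too many vertices: the open orthant on `s` embeds into `E`.
    refine not_injOn_of_finrank_lt (f := Φ ∘ extendZero s) (hgt.trans_eq hfin.symm)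
      isOpen_setOf_forall_pos ⟨fun _ => 1, fun _ => one_pos⟩
      (hΦ.comp (continuous_extendZero s).continuousOn hmaps) fun u hu u' hu' huu => ?_
    have := congrArg Ψ huu
    simp only [Function.comp_apply] at this
    rw [hl _ (hmaps hu), hl _ (hmaps hu')] at this
    ext p
    rw [← extendZero_apply_of_mem u p, this, extendZero_apply_of_mem]

/-- If `q` were the only way to extend `s`, the coordinates in `s` and `q` would embed the open star
of `s` as an open set. Its points satisfy `Ψ u q ≥ 0`, yet it contains a point with this coordinate
zero. -/
theorem ConeHomeo.exists_ne_of_isFace_insert (h : ConeHomeo K E) {s : Finset V}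
    (hcard : s.card + 1 = Module.finrank ℝ E) {q : V} (hq : q ∉ s) (hqf : IsFace K (insert q s)) :
    ∃ q' ∉ s, IsFace K (insert q' s) ∧ q' ≠ q := by
  by_contra! hne
  obtain ⟨Φ, Ψ, hΦ, hΨ, hmem, hl, hr, -⟩ := h
  have hone := extendZero_mem_coneSet (hqf.mono (Finset.subset_insert q s))
    (u := fun _ => 1) fun _ => zero_le_one
  have hz : ∀ u ∈ {u | ∀ p ∈ s, 0 < Ψ u p}, ∀ p ∉ s, p ≠ q → Ψ u p = 0 := by
    intro u hu p hp hpq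
    by_contra hne'
    exact hpq (hne p hp (isFace_insert_of_mem_coneSet (hmem u) hu hne'))
  have hopen := isOpen_image_of_injOn (f := fun u => ((fun p : s => Ψ u p), Ψ u q))
    (U := {u | ∀ p ∈ s, 0 < Ψ u p}) (by simp [← hcard])
    (isOpen_openStar hΨ s) (by fun_prop) (fun u hu u' hu' huu => by
      rw [← hr u, ← hr u']
      congr 1
      ext p
      by_cases hp : p ∈ s
      · exact congrFun (congrArg Prod.fst huu) ⟨p, hp⟩
      · by_cases hpq : p = q
        · rw [hpq]; exact congrArg Prod.snd huu
        · rw [hz u hu p hp hpq, hz u' hu' p hp hpq])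
  have hm : ((fun _ => 1, 0) : (s → ℝ) × ℝ) ∈
      (fun u => ((fun p : s => Ψ u p), Ψ u q)) '' {u | ∀ p ∈ s, 0 < Ψ u p} := by
    refine ⟨Φ (extendZero s fun _ => 1), fun p hp => ?_, ?_⟩
    · rw [hl _ hone, extendZero_apply_of_mem _ ⟨p, hp⟩]; exact one_pos
    · simp only [hl _ hone, extendZero_apply_of_mem, extendZero_apply_of_notMem _ hq]
  have hcont : Continuous fun t : ℝ => ((fun _ => 1, t) : (s → ℝ) × ℝ) := by fun_prop
  have hev := hcont.continuousAt.preimage_mem_nhds (hopen.mem_nhds hm)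
  obtain ⟨ε, hε, hball⟩ := Metric.mem_nhds_iff.1 hev
  obtain ⟨u, -, hu⟩ := hball (show -(ε / 2) ∈ ball (0 : ℝ) ε by
    rw [mem_ball_zero_iff, norm_neg, Real.norm_eq_abs, abs_of_pos (by positivity)]; linarith)
  have h1 : Ψ u q = -(ε / 2) := congrArg Prod.snd hu
  have h2 := (hmem u).1 q
  linarith

/-- Two facets glued along `s` already form a space of full dimension, hence an open set around a
point of `s`; a third facet through that point would have to meet it outside `s`. -/
theorem ConeHomeo.eq_or_eq_of_isFace_insert (h : ConeHomeo K E) {s : Finset V}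
    (hcard : s.card + 1 = Module.finrank ℝ E) {q₁ q₂ q₃ : V} (h12 : q₁ ≠ q₂)
    (hq₁ : q₁ ∉ s) (hf₁ : IsFace K (insert q₁ s)) (hq₂ : q₂ ∉ s) (hf₂ : IsFace K (insert q₂ s))
    (hq₃ : q₃ ∉ s) (hf₃ : IsFace K (insert q₃ s)) : q₃ = q₁ ∨ q₃ = q₂ := by
  by_contra! h3
  obtain ⟨Φ, Ψ, hΦ, hΨ, hmem, hl, hr, -⟩ := h
  -- The positive values of the last coordinate run into `q₁`, the negative ones into `q₂`.
  set j : (s → ℝ) × ℝ → V → ℝ := fun x =>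
    extendZero s x.1 + (Pi.single q₁ (max x.2 0) + Pi.single q₂ (max (-x.2) 0)) with hj
  have hjs : ∀ x (p : s), j x p = x.1 p := by
    intro x p
    have h1 : (p : V) ≠ q₁ := fun h => hq₁ (h ▸ p.2)
    have h2 : (p : V) ≠ q₂ := fun h => hq₂ (h ▸ p.2)
    simp [hj, extendZero_apply_of_mem, h1, h2]
  have hj1 : ∀ x, j x q₁ = max x.2 0 := by
    intro x; simp [hj, extendZero_apply_of_notMem _ hq₁, h12]
  have hj2 : ∀ x, j x q₂ = max (-x.2) 0 := by
    intro x; simp [hj, extendZero_apply_of_notMem _ hq₂, h12.symm]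
  have hj0 : ∀ x, ∀ p ∉ s, p ≠ q₁ → p ≠ q₂ → j x p = 0 := by
    intro x p hp h1 h2; simp [hj, extendZero_apply_of_notMem _ hp, h1, h2]
  have hjc : Continuous j := by
    refine ((continuous_extendZero s).comp continuous_fst).add (Continuous.add ?_ ?_)
    · exact (continuous_single q₁).comp (by fun_prop)
    · exact (continuous_single q₂).comp (by fun_prop)
  set U : Set ((s → ℝ) × ℝ) := {u : s → ℝ | ∀ i, 0 < u i} ×ˢ univ with hU
  have hmaps : MapsTo j U (coneSet K) := by
    rintro x ⟨hx, -⟩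
    have hpos : ∀ p, 0 ≤ j x p := by
      intro p
      by_cases hp : p ∈ s
      · rw [hjs x ⟨p, hp⟩]; exact (hx _).le
      · by_cases h1 : p = q₁
        · rw [h1, hj1]; exact le_max_right _ _
        · by_cases h2 : p = q₂
          · rw [h2, hj2]; exact le_max_right _ _
          · rw [hj0 x p hp h1 h2]
    rcases le_total 0 x.2 with h0 | h0
    · refine ⟨hpos, hf₁.mono fun p hp => ?_⟩
      by_contra hps
      rw [Finset.mem_insert, not_or] at hps
      refine (Finset.mem_filter.1 hp).2 ?_
      by_cases h2 : p = q₂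
      · rw [h2, hj2, max_eq_right (by linarith)]
      · exact hj0 x p hps.2 hps.1 h2
    · refine ⟨hpos, hf₂.mono fun p hp => ?_⟩
      by_contra hps
      rw [Finset.mem_insert, not_or] at hps
      refine (Finset.mem_filter.1 hp).2 ?_
      by_cases h1 : p = q₁
      · rw [h1, hj1, max_eq_right h0]
      · exact hj0 x p hps.2 h1 hps.1
  have hopen := isOpen_image_of_injOn (f := Φ ∘ j) (U := U) (by simp [← hcard])
    (isOpen_setOf_forall_pos.prod isOpen_univ) (hΦ.comp hjc.continuousOn hmaps)
    (fun x hx x' hx' hxx => by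
      have heq := congrArg Ψ hxx
      simp only [Function.comp_apply] at heq
      rw [hl _ (hmaps hx), hl _ (hmaps hx')] at heq
      refine Prod.ext ?_ ?_
      · ext p
        rw [← hjs x p, heq, hjs]
      · have e1 := hj1 x
        have e2 := hj2 x
        rw [heq] at e1 e2
        rw [hj1] at e1
        rw [hj2] at e2
        have e3 : ∀ t : ℝ, t = max t 0 - max (-t) 0 := fun t => by
          rcases le_total 0 t with ht | ht
          · rw [max_eq_left ht, max_eq_right (by linarith), sub_zero]
          · rw [max_eq_right ht, max_eq_left (by linarith)]; ring
        rw [e3 x.2, e3 x'.2, e1, e2])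
  -- A path from the interior of the cone on `s` towards `q₃`. By openness it stays in the image of
  -- `j` for small `t`, where the `q₃` coordinate is zero.
  set γ : ℝ → V → ℝ := fun t => extendZero s (fun _ => 1) + Pi.single q₃ t with hγ
  have hγ0 : γ 0 = j (fun _ => 1, 0) := by simp [hγ, hj]
  have hγm : MapsTo γ (Ici 0) (coneSet K) := by
    intro t ht
    refine ⟨fun p => ?_, hf₃.mono fun p hp => ?_⟩
    · refine add_nonneg ((extendZero_mem_coneSet (hf₃.mono (Finset.subset_insert q₃ s))
        (u := fun _ => 1) fun _ => zero_le_one).1 p) ?_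
      exact (Pi.single_nonneg.2 ht : (0 : V → ℝ) ≤ Pi.single q₃ t) p
    · by_contra hps
      rw [Finset.mem_insert, not_or] at hps
      refine (Finset.mem_filter.1 hp).2 ?_
      simp [hγ, extendZero_apply_of_notMem _ hps.2, hps.1]
  have hγc : Continuous γ := continuous_const.add (continuous_single (A := fun _ : V => ℝ) q₃)
  have hm : (Φ ∘ γ) 0 ∈ (Φ ∘ j) '' U :=
    ⟨(fun _ => 1, 0), ⟨fun _ => one_pos, mem_univ _⟩, by rw [Function.comp_apply,
      Function.comp_apply, hγ0]⟩
  have hcw : ContinuousWithinAt (Φ ∘ γ) (Ici 0) 0 :=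
    (hΦ.comp hγc.continuousOn hγm) 0 self_mem_Ici
  have hev := hcw.preimage_mem_nhdsWithin (hopen.mem_nhds hm)
  obtain ⟨ε, hε, hball⟩ := Metric.mem_nhdsWithin_iff.1 hev
  have hε2 : (0 : ℝ) ≤ ε / 2 := by positivity
  obtain ⟨x, hx, hxe⟩ := hball (show ε / 2 ∈ ball (0 : ℝ) ε ∩ Ici 0 from
    ⟨by rw [mem_ball_zero_iff, Real.norm_eq_abs, abs_of_nonneg hε2]; linarith, hε2⟩)
  have heq := congrArg Ψ hxe
  simp only [Function.comp_apply] at heq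
  rw [hl _ (hmaps hx), hl _ (hγm hε2)] at heq
  have h0 := congrFun heq q₃
  rw [hj0 x q₃ hq₃ h3.1 h3.2] at h0
  simp [hγ, extendZero_apply_of_notMem _ hq₃] at h0
  linarith

end Cone

/-- All facets of `K` have `n` vertices, and every face with `n - 1` vertices lies in exactly two
of them. -/
def IsClosedPseudomanifold {V : Type*} [DecidableEq V] (n : ℕ)
    (K : PreAbstractSimplicialComplex V) : Prop :=
  (∀ s, IsFace K s → (∀ p ∉ s, ¬ IsFace K (insert p s)) → s.card = n) ∧
  ∀ s, IsFace K s → s.card + 1 = n →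
    ∃ q₁ q₂, q₁ ≠ q₂ ∧ ∀ p, p ∉ s ∧ IsFace K (insert p s) ↔ p = q₁ ∨ p = q₂

theorem IsSimplicialSphere.isClosedPseudomanifold {V : Type*} [Fintype V] [DecidableEq V] {d : ℕ}
    {K : PreAbstractSimplicialComplex V} (h : IsSimplicialSphere d K) :
    IsClosedPseudomanifold (d + 1) K := by
  obtain ⟨e⟩ := h
  have hK := coneHomeo_of_homeomorph_sphere e
  have hfin := finrank_euclideanSpace_fin (𝕜 := ℝ) (n := d + 1)
  refine ⟨fun s hs hmax => (hK.card_of_maximal hs hmax).trans hfin, fun s hs hcard => ?_⟩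
  have hcard' := hcard.trans hfin.symm
  obtain ⟨q₁, hq₁, hf₁⟩ : ∃ q ∉ s, IsFace K (insert q s) := by
    by_contra! hmax
    have := hK.card_of_maximal hs hmax
    omega
  obtain ⟨q₂, hq₂, hf₂, hne⟩ := hK.exists_ne_of_isFace_insert hcard' hq₁ hf₁
  refine ⟨q₁, q₂, hne.symm, fun p => ⟨fun hp =>
    hK.eq_or_eq_of_isFace_insert hcard' hne.symm hq₁ hf₁ hq₂ hf₂ hp.1 hp.2, ?_⟩⟩
  rintro (rfl | rfl)
  · exact ⟨hq₁, hf₁⟩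
  · exact ⟨hq₂, hf₂⟩

end FlagSphere

/-! ### Stellar subdivisions preserve the realization -/

namespace FlagSphere

open Set Metric
open scoped Topology

section Stellar

variable {V : Type*} [DecidableEq V]

/-- `K'` is the stellar subdivision of `K` at `F` with new vertex `u`. -/
def IsStellarSubdivision (K' K : PreAbstractSimplicialComplex V) (F : Finset V) (u : V) : Prop :=
  ∀ s, IsFace K' s ↔ ¬ F ⊆ s ∧ (u ∉ s ∧ IsFace K s ∨ u ∈ s ∧ IsFace K (s.erase u ∪ F))

/-- Removing the vertex `u` introduced by a stellar subdivision at `F`. -/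
noncomputable def unsubdivide (F : Finset V) (u : V) (w : V → ℝ) : V → ℝ := fun p =>
  w p + (if p ∈ F then w u / F.card else 0) - if p = u then w u else 0

/-- Moving the common weight of the vertices of `F` to a new vertex `u`. -/
noncomputable def subdivide (F : Finset V) (hF : F.Nonempty) (u : V) (w : V → ℝ) : V → ℝ :=
  fun p => w p - (if p ∈ F then F.inf' hF w else 0) + if p = u then F.card * F.inf' hF w else 0

theorem continuous_unsubdivide (F : Finset V) (u : V) : Continuous (unsubdivide F u) := by
  refine continuous_pi fun p => ?_
  unfold unsubdivide
  split_ifs <;> fun_prop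

theorem continuous_subdivide {F : Finset V} (hF : F.Nonempty) (u : V) :
    Continuous (subdivide F hF u) := by
  have : Continuous fun w : V → ℝ => F.inf' hF w :=
    Continuous.finset_inf'_apply hF fun p _ => continuous_apply p
  refine continuous_pi fun p => ?_
  unfold subdivide
  split_ifs <;> fun_prop

variable [Fintype V]

theorem sum_unsubdivide {F : Finset V} (hF : F.Nonempty) (u : V) (w : V → ℝ) :
    ∑ p, unsubdivide F u w p = ∑ p, w p := by
  have : (F.card : ℝ) ≠ 0 := by exact_mod_cast hF.card_pos.ne'
  simp only [unsubdivide, Finset.sum_sub_distrib, Finset.sum_add_distrib, Finset.sum_ite_mem,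
    Finset.sum_ite_eq', Finset.univ_inter, Finset.sum_const, nsmul_eq_mul, Finset.mem_univ, if_true]
  field_simp
  ring

theorem sum_subdivide {F : Finset V} (hF : F.Nonempty) (u : V) (w : V → ℝ) :
    ∑ p, subdivide F hF u w p = ∑ p, w p := by
  simp only [subdivide, Finset.sum_sub_distrib, Finset.sum_add_distrib, Finset.sum_ite_mem,
    Finset.sum_ite_eq', Finset.univ_inter, Finset.sum_const, nsmul_eq_mul, Finset.mem_univ, if_true]
  ring

variable {K K' : PreAbstractSimplicialComplex V} {F : Finset V} {u : V}

theorem IsStellarSubdivision.unsubdivide_mem (h : IsStellarSubdivision K' K F u) (hu : u ∉ F)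
    {w : V → ℝ} (hw : w ∈ coneSet K') : unsubdivide F u w ∈ coneSet K := by
  constructor
  · intro p
    by_cases hp : p = u
    · subst hp; simp [unsubdivide, hu]
    · have h1 := hw.1 p
      have h2 := hw.1 u
      have : 0 ≤ if p ∈ F then w u / F.card else 0 := by split_ifs <;> positivity
      simp only [unsubdivide, hp, if_false]
      linarith
  · obtain ⟨-, ⟨hus, hs⟩ | ⟨-, hs⟩⟩ := (h _).1 hw.2
    · refine hs.mono fun p hp => ?_
      have hu0 : w u = 0 := by simpa using hus
      simpa [unsubdivide, hu0] using hp
    · refine hs.mono fun p hp => ?_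
      by_contra hps
      simp only [Finset.mem_union, Finset.mem_erase, Finset.mem_filter, Finset.mem_univ, true_and,
        not_or, not_and, not_not] at hps
      refine (Finset.mem_filter.1 hp).2 ?_
      by_cases hpu : p = u
      · subst hpu; simp [unsubdivide, hu]
      · simp [unsubdivide, hps.2, hpu, hps.1 hpu]

theorem IsStellarSubdivision.subdivide_mem (h : IsStellarSubdivision K' K F u) (hF : F.Nonempty)
    (hu : u ∉ F) (huK : ∀ s, IsFace K s → u ∉ s) {w : V → ℝ} (hw : w ∈ coneSet K) :
    subdivide F hF u w ∈ coneSet K' := by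
  obtain ⟨q, hq, hqm⟩ := Finset.exists_mem_eq_inf' hF w
  have hm0 : 0 ≤ F.inf' hF w := (Finset.le_inf'_iff hF _).2 fun p _ => hw.1 p
  have hqu : q ≠ u := fun h => hu (h ▸ hq)
  have hwu : w u = 0 := by simpa using huK _ hw.2
  -- The vertex of `F` with least weight loses all of it, so the new support does not contain `F`.
  have hq0 : subdivide F hF u w q = 0 := by simp [subdivide, hq, hqu, hqm]
  constructor
  · intro p
    have h1 := hw.1 p
    have h2 : 0 ≤ if p = u then F.card * F.inf' hF w else 0 := by
      split_ifs
      · positivity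
      · exact le_rfl
    simp only [subdivide]
    by_cases hp : p ∈ F
    · have := Finset.inf'_le w hp
      simp only [hp, if_true]
      linarith
    · simp only [hp, if_false]
      linarith
  · refine (h _).2 ⟨fun hsub => (Finset.mem_filter.1 (hsub hq)).2 hq0, ?_⟩
    rcases hm0.eq_or_lt with h0 | hpos
    · have hself : subdivide F hF u w = w := by ext p; simp [subdivide, ← h0]
      rw [hself]
      exact Or.inl ⟨huK _ hw.2, hw.2⟩
    · refine Or.inr ⟨?_, hw.2.mono fun p hp => ?_⟩
      · have : (0 : ℝ) < F.card := by exact_mod_cast hF.card_pos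
        have hval : subdivide F hF u w u = F.card * F.inf' hF w := by simp [subdivide, hu, hwu]
        rw [Finset.mem_filter, hval]
        exact ⟨Finset.mem_univ _, (mul_pos this hpos).ne'⟩
      · rw [Finset.mem_filter]
        refine ⟨Finset.mem_univ _, ?_⟩
        rcases Finset.mem_union.1 hp with hp | hp
        · obtain ⟨hpu, hp⟩ := Finset.mem_erase.1 hp
          intro hp0
          refine (Finset.mem_filter.1 hp).2 ?_
          have hpF : p ∉ F := fun hpF => by
            have := Finset.inf'_le w hpF
            rw [hp0] at this
            linarith
          simp [subdivide, hp0, hpF, hpu]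
        · have := Finset.inf'_le w hp
          exact (hpos.trans_le this).ne'

/-- No face of `K'` contains `F`, so some vertex of `F` has weight zero. After spreading the weight
of `u` evenly, the minimum over `F` is therefore exactly `w u / F.card`, and the weight of `u` is
recovered. -/
theorem subdivide_unsubdivide (h : IsStellarSubdivision K' K F u) (hF : F.Nonempty) (hu : u ∉ F)
    {w : V → ℝ} (hw : w ∈ coneSet K') : subdivide F hF u (unsubdivide F u w) = w := by
  have hval : ∀ p ∈ F, unsubdivide F u w p = w p + w u / F.card := fun p hp => by
    have : p ≠ u := fun h => hu (h ▸ hp)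
    simp [unsubdivide, hp, this]
  have hm : F.inf' hF (unsubdivide F u w) = w u / F.card := by
    obtain ⟨q, hq, hqs⟩ := Finset.not_subset.1 ((h _).1 hw.2).1
    have hq0 : w q = 0 := by simpa using hqs
    refine le_antisymm ?_ ((Finset.le_inf'_iff hF _).2 fun p hp => ?_)
    · refine (Finset.inf'_le _ hq).trans ?_
      rw [hval q hq, hq0, zero_add]
    · rw [hval p hp]
      exact le_add_of_nonneg_left (hw.1 p)
  have hc : (F.card : ℝ) ≠ 0 := by exact_mod_cast hF.card_pos.ne'
  ext p
  simp only [subdivide, hm]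
  by_cases hpu : p = u
  · subst hpu
    simp only [unsubdivide, hu, if_false, if_true]
    field_simp
    ring
  · simp only [unsubdivide, hpu, if_false]
    ring

theorem unsubdivide_subdivide (hF : F.Nonempty) (hu : u ∉ F) (huK : ∀ s, IsFace K s → u ∉ s)
    {w : V → ℝ} (hw : w ∈ coneSet K) : unsubdivide F u (subdivide F hF u w) = w := by
  have hwu : w u = 0 := by simpa using huK _ hw.2
  have hc : (F.card : ℝ) ≠ 0 := by exact_mod_cast hF.card_pos.ne'
  have hval : subdivide F hF u w u = F.card * F.inf' hF w := by simp [subdivide, hu, hwu]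
  ext p
  simp only [unsubdivide, hval]
  rw [mul_div_cancel_left₀ _ hc]
  simp only [subdivide]
  by_cases hpu : p = u
  · subst hpu; simp [hu]
  · simp only [hpu, if_false]; ring

/-- A stellar subdivision does not change the geometric realization up to homeomorphism. -/
theorem IsStellarSubdivision.nonempty_homeomorph (h : IsStellarSubdivision K' K F u)
    (hF : F.Nonempty) (hu : u ∉ F) (huK : ∀ s, IsFace K s → u ∉ s) :
    Nonempty (realization K' ≃ₜ realization K) := by
  have h1 : ∀ w ∈ realization K', unsubdivide F u w ∈ realization K := fun w hw =>
    mem_realization_iff.2 ⟨h.unsubdivide_mem hu (mem_realization_iff.1 hw).1,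
      (sum_unsubdivide hF u w).trans hw.2.1⟩
  have h2 : ∀ w ∈ realization K, subdivide F hF u w ∈ realization K' := fun w hw =>
    mem_realization_iff.2 ⟨h.subdivide_mem hF hu huK (mem_realization_iff.1 hw).1,
      (sum_subdivide hF u w).trans hw.2.1⟩
  exact ⟨{ toFun := fun w => ⟨unsubdivide F u w, h1 w w.2⟩
           invFun := fun w => ⟨subdivide F hF u w, h2 w w.2⟩
           left_inv := fun w => Subtype.ext
             (subdivide_unsubdivide h hF hu (mem_realization_iff.1 w.2).1)
           right_inv := fun w => Subtype.ext
             (unsubdivide_subdivide hF hu huK (mem_realization_iff.1 w.2).1)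
           continuous_toFun :=
             ((continuous_unsubdivide F u).comp continuous_subtype_val).subtype_mk _
           continuous_invFun :=
             ((continuous_subdivide hF u).comp continuous_subtype_val).subtype_mk _ }⟩

end Stellar

/-! ### Realizations under injective relabelling of vertices -/

section Relabel

variable {V W : Type*} [Fintype V] [Fintype W] [DecidableEq W]

theorem mem_coneSet_map_iff {K : PreAbstractSimplicialComplex V} {f : V → W}
    (hf : Function.Injective f) {w : W → ℝ} :
    w ∈ coneSet (K.map f) ↔ w ∘ f ∈ coneSet K ∧ ∀ q ∉ range f, w q = 0 := by
  constructor
  · rintro ⟨h0, hs⟩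
    obtain ⟨t, ht, hst⟩ := isFace_map_iff.1 hs
    refine ⟨⟨fun p => h0 _, ht.mono fun p hp => ?_⟩, fun q hq => ?_⟩
    · have hp' : f p ∈ Finset.univ.filter fun q => w q ≠ 0 := by simpa using hp
      rw [hst] at hp'
      obtain ⟨p', hp1, hp2⟩ := Finset.mem_image.1 hp'
      exact hf hp2 ▸ hp1
    · by_contra hne
      have hq' : q ∈ Finset.univ.filter fun q => w q ≠ 0 := by simpa using hne
      rw [hst] at hq'
      obtain ⟨p, -, rfl⟩ := Finset.mem_image.1 hq'
      exact hq ⟨p, rfl⟩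
  · rintro ⟨⟨h0, hs⟩, hz⟩
    have hr : ∀ q, w q ≠ 0 → ∃ p, f p = q := fun q hq => by
      by_contra h
      exact hq (hz q h)
    refine ⟨fun q => ?_, isFace_map_iff.2 ⟨_, hs, ?_⟩⟩
    · by_cases hq : w q = 0
      · exact hq.ge
      · obtain ⟨p, rfl⟩ := hr q hq
        exact h0 p
    · ext q
      simp only [Finset.mem_filter, Finset.mem_univ, true_and, Finset.mem_image,
        Function.comp_apply]
      constructor
      · intro hq
        obtain ⟨p, rfl⟩ := hr q hq
        exact ⟨p, hq, rfl⟩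
      · rintro ⟨p, hp, rfl⟩
        exact hp

theorem nonempty_homeomorph_map (K : PreAbstractSimplicialComplex V) {f : V → W}
    (hf : Function.Injective f) : Nonempty (realization (K.map f) ≃ₜ realization K) := by
  have hsum : ∀ w : W → ℝ, (∀ q ∉ range f, w q = 0) → ∑ p, w (f p) = ∑ q, w q := fun w hw => by
    rw [← Finset.sum_image (f := w) (s := Finset.univ) (g := f) hf.injOn]
    exact Finset.sum_subset (Finset.subset_univ _) fun q _ hq => hw q fun ⟨p, hp⟩ =>
      hq (Finset.mem_image.2 ⟨p, Finset.mem_univ p, hp⟩)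
  have hext0 : ∀ (w : V → ℝ), ∀ q ∉ range f, Function.extend f w 0 q = 0 := fun w q hq =>
    Function.extend_apply' _ _ _ hq
  have h1 : ∀ w ∈ realization (K.map f), w ∘ f ∈ realization K := fun w hw => by
    obtain ⟨hc, hw1⟩ := mem_realization_iff.1 hw
    obtain ⟨hc, hz⟩ := (mem_coneSet_map_iff hf).1 hc
    exact mem_realization_iff.2 ⟨hc, (hsum w hz).trans hw1⟩
  have h2 : ∀ w ∈ realization K, Function.extend f w 0 ∈ realization (K.map f) := fun w hw => by
    obtain ⟨hc, hw1⟩ := mem_realization_iff.1 hw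
    refine mem_realization_iff.2 ⟨(mem_coneSet_map_iff hf).2
      ⟨by rwa [Function.extend_comp hf], hext0 w⟩, ?_⟩
    rw [← hsum _ (hext0 w)]
    simpa only [hf.extend_apply] using hw1
  have hc1 : Continuous fun w : W → ℝ => w ∘ f := continuous_pi fun p => continuous_apply (f p)
  have hc2 : Continuous fun w : V → ℝ => Function.extend f w 0 := by
    refine continuous_pi fun q => ?_
    by_cases hq : ∃ p, f p = q
    · obtain ⟨p, rfl⟩ := hq
      simpa only [hf.extend_apply] using continuous_apply p
    · simpa only [Function.extend_apply' _ _ _ hq] using continuous_const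
  exact ⟨{ toFun := fun w => ⟨w ∘ f, h1 w w.2⟩
           invFun := fun w => ⟨Function.extend f w 0, h2 w w.2⟩
           left_inv := fun w => Subtype.ext (by
             ext q
             by_cases hq : ∃ p, f p = q
             · obtain ⟨p, rfl⟩ := hq
               simp [hf.extend_apply]
             · exact (Function.extend_apply' _ _ _ hq).trans (((mem_coneSet_map_iff hf).1 (mem_realization_iff.1 w.2).1).2 q hq).symm)
           right_inv := fun w => Subtype.ext (Function.extend_comp hf _ _)
           continuous_toFun := (hc1.comp continuous_subtype_val).subtype_mk _
           continuous_invFun := (hc2.comp continuous_subtype_val).subtype_mk _ }⟩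

end Relabel

end FlagSphere

/-! ### Complexes as bit masks, and bistellar flips -/

namespace FlagSphere

open Set Metric
open scoped Topology

section BitMasks

/-- The complex on `Fin n` whose facets are given by the binary digits of the numbers in `L`. -/
def maskComplex (n : ℕ) (L : List ℕ) : PreAbstractSimplicialComplex (Fin n) where
  faces := {s | s.Nonempty ∧ ∃ m ∈ L, ∀ i ∈ s, m.testBit i}
  isRelLowerSet_faces := by
    rintro s ⟨hs, m, hm, hsm⟩
    exact ⟨hs, fun t hts ht => ⟨ht, m, hm, fun i hi => hsm i (hts hi)⟩⟩

theorem isFace_maskComplex_iff {n : ℕ} {L : List ℕ} {s : Finset (Fin n)} :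
    IsFace (maskComplex n L) s ↔ s = ∅ ∨ ∃ m ∈ L, ∀ i ∈ s, m.testBit i := by
  constructor
  · rintro (h | h)
    · exact Or.inl h
    · exact Or.inr h.2
  · intro h
    rcases s.eq_empty_or_nonempty with hs | hs
    · exact Or.inl hs
    · exact Or.inr ⟨hs, h.resolve_left hs.ne_empty⟩

theorem maskComplex_congr {n : ℕ} {L L' : List ℕ} (h : ∀ m, m ∈ L ↔ m ∈ L') :
    maskComplex n L = maskComplex n L' :=
  ext_isFace fun s => by simp only [isFace_maskComplex_iff, h]

theorem map_eq_maskComplex {V : Type*} [Fintype V] {K : PreAbstractSimplicialComplex V} {n : ℕ}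
    {f : V → Fin n} {L : List ℕ}
    (hK : ∀ t, IsFace K t ↔ t = ∅ ∨ ∃ m ∈ L, ∀ p ∈ t, m.testBit (f p))
    (hL : ∀ m ∈ L, ∀ j : Fin n, m.testBit j → ∃ p, f p = j) : K.map f = maskComplex n L := by
  refine ext_isFace fun s => ?_
  rw [isFace_map_iff, isFace_maskComplex_iff]
  constructor
  · rintro ⟨t, ht, rfl⟩
    rcases (hK t).1 ht with rfl | ⟨m, hm, hmt⟩
    · exact Or.inl rfl
    · exact Or.inr ⟨m, hm, fun i hi => by
        obtain ⟨p, hp, rfl⟩ := Finset.mem_image.1 hi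
        exact hmt p hp⟩
  · rintro (rfl | ⟨m, hm, hms⟩)
    · exact ⟨∅, Or.inl rfl, rfl⟩
    · refine ⟨Finset.univ.filter fun p => f p ∈ s, (hK _).2 (Or.inr ⟨m, hm, fun p hp =>
        hms _ (Finset.mem_filter.1 hp).2⟩), ?_⟩
      ext i
      simp only [Finset.mem_image, Finset.mem_filter, Finset.mem_univ, true_and]
      constructor
      · intro hi
        obtain ⟨p, rfl⟩ := hL m hm i (hms i hi)
        exact ⟨p, hi, rfl⟩
      · rintro ⟨p, hp, rfl⟩
        exact hp

/-- The facets of the stellar subdivision at the face `A`, with new vertex `u`. -/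
def stellarList (u : ℕ) (A L : List ℕ) : List ℕ :=
  (L.filter fun m => !A.all fun i => m.testBit i) ++
    (L.filter fun m => A.all fun i => m.testBit i).flatMap fun m =>
      A.map fun i => (m ^^^ 2 ^ i) ||| 2 ^ u

/-- The facets after replacing the subcomplex `A * ∂B` by `∂A * B`. -/
def flipList (A B L : List ℕ) : List ℕ :=
  (L.filter fun m => !A.all fun i => m.testBit i) ++
    A.map fun i => (A ++ B).foldr (fun j m => 2 ^ j ||| m) 0 ^^^ 2 ^ i

/-- `A` is a list of vertices other than `u`, and `u` is not a vertex of a set in `L`. -/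
def canSubdivide (n u : ℕ) (A L : List ℕ) : Bool :=
  !A.isEmpty && A.all (fun i => decide (i < n) && !decide (i = u)) && L.all fun m => !m.testBit u

def sameElements (L L' : List ℕ) : Bool :=
  L.all (fun m => L'.contains m) && L'.all fun m => L.contains m

/-- A flip is certified by comparing facets: subdividing at `A` before it and at `B` after it must
give the same complex. No condition on the link of `A` has to be tested separately. -/
def checkFlips (n u : ℕ) (Lend : List ℕ) : List (List ℕ × List ℕ) → List ℕ → Bool
  | [], L => sameElements L Lend
  | (A, B) :: moves, L =>
    canSubdivide n u A L && canSubdivide n u B (flipList A B L) &&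
      sameElements (stellarList u A L) (stellarList u B (flipList A B L)) &&
      checkFlips n u Lend moves (flipList A B L)

theorem mem_iff_of_sameElements {L L' : List ℕ} (h : sameElements L L' = true) (m : ℕ) :
    m ∈ L ↔ m ∈ L' := by
  simp only [sameElements, Bool.and_eq_true, List.all_eq_true, List.contains_iff_mem] at h
  exact ⟨h.1 m, h.2 m⟩

theorem mem_stellarList_iff {u m : ℕ} {A L : List ℕ} :
    m ∈ stellarList u A L ↔ (m ∈ L ∧ ∃ i ∈ A, m.testBit i = false) ∨
      ∃ m₀ ∈ L, (∀ i ∈ A, m₀.testBit i) ∧ ∃ i ∈ A, (m₀ ^^^ 2 ^ i) ||| 2 ^ u = m := by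
  simp [stellarList, and_assoc]

theorem isStellarSubdivision_stellarList {n : ℕ} (u : Fin n) {A L : List ℕ}
    (h : canSubdivide n u A L = true) :
    IsStellarSubdivision (maskComplex n (stellarList u A L)) (maskComplex n L)
      (Finset.univ.filter fun i : Fin n => (i : ℕ) ∈ A) u := by
  simp only [canSubdivide, Bool.and_eq_true, Bool.not_eq_true', List.isEmpty_eq_false_iff,
    List.all_eq_true, decide_eq_true_eq, decide_eq_false_iff_not] at h
  obtain ⟨⟨hA, hAn⟩, hLu⟩ := h
  intro s
  simp only [isFace_maskComplex_iff, mem_stellarList_iff]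
  set F := Finset.univ.filter fun i : Fin n => (i : ℕ) ∈ A with hF
  have hmF : ∀ i : Fin n, i ∈ F ↔ (i : ℕ) ∈ A := fun i => by simp [hF]
  have huF : u ∉ F := fun hu => (hAn _ ((hmF u).1 hu)).2 rfl
  have hbit : ∀ (m₀ : ℕ) (i j : Fin n), ((m₀ ^^^ 2 ^ (i : ℕ)) ||| 2 ^ (u : ℕ)).testBit j =
      ((m₀.testBit j ^^ decide (i = j)) || decide (u = j)) := fun m₀ i j => by
    simp [Nat.testBit_two_pow, Fin.ext_iff]
  constructor
  · rintro (rfl | ⟨m, ⟨hm, i, hi, hmi⟩ | ⟨m₀, hm₀, hAm, i, hi, rfl⟩, hs⟩)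
    · refine ⟨fun hsub => ?_, Or.inl ⟨Finset.notMem_empty u, Or.inl rfl⟩⟩
      obtain ⟨i, hi⟩ := List.exists_mem_of_ne_nil A hA
      exact Finset.notMem_empty _ (hsub ((hmF ⟨i, (hAn i hi).1⟩).2 hi))
    · refine ⟨fun hsub => ?_, Or.inl ⟨fun hu => ?_, Or.inr ⟨m, hm, hs⟩⟩⟩
      · have := hs _ (hsub ((hmF ⟨i, (hAn i hi).1⟩).2 hi))
        simp [hmi] at this
      · have := hs u hu
        simp [hLu m hm] at this
    · set i' : Fin n := ⟨i, (hAn i hi).1⟩ with hi'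
      have hiu : u ≠ i' := fun h => (hAn i hi).2 (by rw [h])
      have hs' : ∀ j ∈ s, ((m₀.testBit j ^^ decide (i' = j)) || decide (u = j)) = true :=
        fun j hj => (hbit m₀ i' j).symm.trans (hs j hj)
      have hi's : i' ∉ s := fun h => by
        have := hs' i' h
        simp [hAm i hi, hi'] at this
        exact hiu (by simpa [hi'] using this)
      refine ⟨fun hsub => hi's (hsub ((hmF i').2 hi)), ?_⟩
      have hsm : ∀ j ∈ s, j ≠ u → m₀.testBit j = true := fun j hj hju => by
        have := hs' j hj
        have hne : i' ≠ j := fun h => hi's (h ▸ hj)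
        simpa [hju.symm, hne] using this
      by_cases hu : u ∈ s
      · refine Or.inr ⟨hu, Or.inr ⟨m₀, hm₀, fun j hj => ?_⟩⟩
        rcases Finset.mem_union.1 hj with hj | hj
        · exact hsm j (Finset.mem_of_mem_erase hj) (Finset.ne_of_mem_erase hj)
        · exact hAm j ((hmF j).1 hj)
      · exact Or.inl ⟨hu, Or.inr ⟨m₀, hm₀, fun j hj => hsm j hj fun h => hu (h ▸ hj)⟩⟩
  · rintro ⟨hFs, hs⟩
    by_cases hs0 : s = ∅
    · exact Or.inl hs0
    right
    -- A vertex of `F` missing from `s` tells which vertex of a facet to trade for `u`.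
    obtain ⟨i, hiF, his⟩ := Finset.not_subset.1 hFs
    have hiu : i ≠ u := fun h => huF (h ▸ hiF)
    have hin : ∀ m₀ : ℕ, ∀ j ∈ s, (j ≠ u → m₀.testBit j = true) →
        ((m₀ ^^^ 2 ^ (i : ℕ)) ||| 2 ^ (u : ℕ)).testBit j = true := fun m₀ j hj hm => by
      rw [hbit]
      have hne : i ≠ j := fun h => his (h ▸ hj)
      by_cases hju : u = j
      · simp [hju]
      · simp [hne, hm fun h => hju h.symm]
    rcases hs with ⟨hu, hs⟩ | ⟨hu, hs⟩
    · obtain ⟨m₀, hm₀, hsm⟩ := hs.resolve_left hs0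
      by_cases hAm : ∀ i ∈ A, m₀.testBit i = true
      · exact ⟨_, Or.inr ⟨m₀, hm₀, hAm, i, (hmF i).1 hiF, rfl⟩, fun j hj =>
          hin m₀ j hj fun _ => hsm j hj⟩
      · push Not at hAm
        obtain ⟨l, hl, hlm⟩ := hAm
        exact ⟨m₀, Or.inl ⟨hm₀, l, hl, by simpa using hlm⟩, hsm⟩
    · have hne : s.erase u ∪ F ≠ ∅ :=
        Finset.ne_empty_of_mem (Finset.mem_union_right _ hiF)
      obtain ⟨m₀, hm₀, hsm⟩ := hs.resolve_left hne
      refine ⟨_, Or.inr ⟨m₀, hm₀, fun l hl => ?_, i, (hmF i).1 hiF, rfl⟩, fun j hj =>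
        hin m₀ j hj fun hju => hsm j (Finset.mem_union_left _ (Finset.mem_erase.2 ⟨hju, hj⟩))⟩
      exact hsm ⟨l, (hAn l hl).1⟩ (Finset.mem_union_right _ ((hmF _).2 hl))

theorem nonempty_homeomorph_stellarList {n : ℕ} (u : Fin n) {A L : List ℕ}
    (h : canSubdivide n u A L = true) :
    Nonempty (realization (maskComplex n (stellarList u A L)) ≃ₜ
      realization (maskComplex n L)) := by
  have hst := isStellarSubdivision_stellarList u h
  simp only [canSubdivide, Bool.and_eq_true, Bool.not_eq_true', List.isEmpty_eq_false_iff,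
    List.all_eq_true, decide_eq_true_eq, decide_eq_false_iff_not] at h
  obtain ⟨⟨hA, hAn⟩, hLu⟩ := h
  obtain ⟨i, hi⟩ := List.exists_mem_of_ne_nil A hA
  refine hst.nonempty_homeomorph ⟨⟨i, (hAn i hi).1⟩, by simpa using hi⟩
    (fun hu => (hAn u (by simpa using hu)).2 rfl) fun s hs hu => ?_
  obtain ⟨m, hm, hsm⟩ := (isFace_maskComplex_iff.1 hs).resolve_left (Finset.ne_empty_of_mem hu)
  have := hsm u hu
  simp [hLu m hm] at this

theorem nonempty_homeomorph_of_checkFlips {n : ℕ} (u : Fin n) {Lend : List ℕ}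
    {moves : List (List ℕ × List ℕ)} {L : List ℕ} (h : checkFlips n u Lend moves L = true) :
    Nonempty (realization (maskComplex n L) ≃ₜ realization (maskComplex n Lend)) := by
  induction moves generalizing L with
  | nil =>
    rw [maskComplex_congr (mem_iff_of_sameElements h)]
    exact ⟨Homeomorph.refl _⟩
  | cons move moves ih =>
    obtain ⟨A, B⟩ := move
    simp only [checkFlips, Bool.and_eq_true] at h
    obtain ⟨⟨⟨hA, hB⟩, hAB⟩, hrest⟩ := h
    obtain ⟨e₁⟩ := nonempty_homeomorph_stellarList u hA
    obtain ⟨e₂⟩ := nonempty_homeomorph_stellarList u hB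
    obtain ⟨e₃⟩ := ih hrest
    rw [maskComplex_congr (mem_iff_of_sameElements hAB)] at e₁
    exact ⟨e₁.symm.trans (e₂.trans e₃)⟩

end BitMasks

/-- The facets of `Δ_{12,33}`; the `i`-th vertex of the `l`-th letter is coded by `3 * l + i`. -/
def facetMasks : List ℕ :=
  [57, 60, 113, 169, 225, 281, 337, 393, 449, 450, 556, 680, 898, 904, 1052, 1304, 1346, 1360, 1548,
    1794, 1800, 2100, 2160, 2242, 2272, 2596, 2690, 2720, 3092, 3138, 3152, 3586, 3588]

/-- The facets of the boundary of the cross-polytope with the antipodal pairs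
`{0, 3}, {1, 4}, {6, 8}, {2, 5}`. -/
def crossPolytopeMasks : List ℕ :=
  [71, 78, 85, 92, 99, 106, 113, 120, 263, 270, 277, 284, 291, 298, 305, 312]

/-- A sequence of bistellar flips from `Δ_{12,33}` to the boundary of a cross-polytope. -/
def flips : List (List ℕ × List ℕ) :=
  [([0, 5, 7], [3, 6]), ([1, 10, 11], [6, 9]), ([2, 10, 11], [4, 9]), ([10, 11], [4, 6, 9]),
    ([2, 11], [4, 5, 9]), ([0, 5], [3, 4, 6]), ([2, 10], [3, 4, 9]), ([2], [3, 4, 5, 9]),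
    ([3, 10], [4, 8, 9]), ([4, 10], [6, 8, 9]), ([10], [1, 6, 8, 9]), ([4, 11], [5, 6, 9]),
    ([4, 5], [3, 6, 9]), ([1, 11], [6, 7, 9]), ([1], [6, 7, 8, 9]), ([11], [5, 6, 7, 9]),
    ([5], [3, 6, 7, 9]), ([7, 9], [3, 6, 8]), ([9], [3, 4, 6, 8]), ([7], [0, 3, 6, 8]),
    ([0, 3, 6, 8], [5]), ([0, 3, 8], [4, 5]), ([3, 4, 6, 8], [2]), ([4, 6, 8], [0, 2]),
    ([0, 2, 6, 8], [1]), ([0, 6, 8], [1, 5]), ([2, 6, 8], [1, 3]), ([0, 3], [4, 5, 6]),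
    ([6, 8], [1, 3, 5])]

/-- The twelve vertices have codes 0 to 11; the thirteenth, 12, is the auxiliary subdivision vertex.
-/
theorem checkFlips_flips : checkFlips 13 12 crossPolytopeMasks flips facetMasks = true := by
  decide +kernel

end FlagSphere

/-! ### The facets of the complex, and its identification with the 3-sphere -/

namespace FlagSphere

open Set Metric
open scoped Topology

section Faces

variable {V : Type*}

theorem isFace_generatedBy_iff {𝓕 : Set (Finset V)} {s : Finset V} :
    IsFace (generatedBy 𝓕) s ↔ s = ∅ ∨ ∃ f ∈ 𝓕, s ⊆ f := by
  constructor
  · rintro (h | h)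
    · exact Or.inl h
    · exact Or.inr h.2
  · intro h
    rcases s.eq_empty_or_nonempty with hs | hs
    · exact Or.inl hs
    · exact Or.inr ⟨hs, h.resolve_left hs.ne_empty⟩

theorem isFace_sup_iff {K L : PreAbstractSimplicialComplex V} {s : Finset V} :
    IsFace (K ⊔ L) s ↔ IsFace K s ∨ IsFace L s := by
  have : s ∈ K ⊔ L ↔ s ∈ K ∨ s ∈ L := Iff.rfl
  simp only [IsFace, this]
  tauto

theorem isFace_join_iff [DecidableEq V] {K L : PreAbstractSimplicialComplex V} {s : Finset V} :
    IsFace (join K L) s ↔ ∃ F G, IsFace K F ∧ IsFace L G ∧ s = F ∪ G := by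
  constructor
  · rintro (rfl | ⟨-, h⟩)
    · exact ⟨∅, ∅, Or.inl rfl, Or.inl rfl, rfl⟩
    · exact h
  · intro h
    rcases s.eq_empty_or_nonempty with hs | hs
    · exact Or.inl hs
    · exact Or.inr ⟨hs, h⟩

/-- A facet of a cross-polytope is a choice `e` of one vertex from each antipodal pair. -/
theorem isFace_diamond_iff [DecidableEq V] {d : ℕ} {p q : Fin d → V} {s : Finset V} :
    IsFace (diamond p q) s ↔
      ∃ e : Fin d → Bool, s ⊆ Finset.univ.image fun i => if e i then p i else q i := by
  rw [diamond, isFace_iJoin_iff]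
  constructor
  · rintro ⟨F, hF, rfl⟩
    have : ∀ i, ∃ e : Bool, F i ⊆ {if e then p i else q i} := by
      intro i
      rcases isFace_generatedBy_iff.1 (hF i) with h | ⟨f, rfl | rfl, hf⟩
      · exact ⟨true, by simp [h]⟩
      · exact ⟨true, by simpa using hf⟩
      · exact ⟨false, by simpa using hf⟩
    choose e he using this
    refine ⟨e, fun r hr => ?_⟩
    obtain ⟨i, -, hi⟩ := Finset.mem_biUnion.1 hr
    exact Finset.mem_image.2 ⟨i, Finset.mem_univ i, (Finset.mem_singleton.1 (he i hi)).symm⟩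
  · rintro ⟨e, he⟩
    refine ⟨fun i => s ∩ {if e i then p i else q i}, fun i => isFace_generatedBy_iff.2 (Or.inr ?_),
      ?_⟩
    · cases h : e i
      · exact ⟨{q i}, Or.inr rfl, Finset.inter_subset_right.trans (by simp [h])⟩
      · exact ⟨{p i}, Or.inl rfl, Finset.inter_subset_right.trans (by simp [h])⟩
    · rw [← Finset.inter_biUnion]
      refine (Finset.inter_eq_left.2 fun r hr => ?_).symm
      obtain ⟨i, -, hi⟩ := Finset.mem_image.1 (he hr)
      exact Finset.mem_biUnion.2 ⟨i, Finset.mem_univ i, Finset.mem_singleton.2 hi.symm⟩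

theorem isFace_cone_diamond_iff [DecidableEq V] {d : ℕ} {r : V} {p q : Fin d → V}
    {s : Finset V} : IsFace (join (generatedBy {{r}}) (diamond p q)) s ↔
      ∃ e : Fin d → Bool, s ⊆ insert r (Finset.univ.image fun i => if e i then p i else q i) := by
  simp only [isFace_join_iff, isFace_diamond_iff, isFace_generatedBy_iff]
  constructor
  · rintro ⟨F, G, hF, ⟨e, he⟩, rfl⟩
    refine ⟨e, Finset.union_subset ?_ (he.trans (Finset.subset_insert _ _))⟩
    rcases hF with rfl | ⟨f, rfl, hf⟩
    · exact Finset.empty_subset _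
    · exact hf.trans (by simp)
  · rintro ⟨e, he⟩
    refine ⟨s ∩ {r}, s ∩ Finset.univ.image fun i => if e i then p i else q i,
      Or.inr ⟨{r}, rfl, Finset.inter_subset_right⟩, ⟨e, Finset.inter_subset_right⟩, ?_⟩
    rw [← Finset.inter_union_distrib_left, Finset.singleton_union, Finset.inter_eq_left.2 he]

end Faces

/-- The position of a vertex in the bit masks. -/
def code (p : Vertex) : ℕ := 3 * p.1 + p.2

theorem code_injective : Function.Injective code := by
  rintro ⟨i, j⟩ ⟨i', j'⟩ h
  simp only [code] at h
  refine Prod.ext (Fin.ext ?_) (Fin.ext ?_) <;> dsimp only <;> omega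

/-- The bit mask of a list of vertices. -/
def maskOf (f : List Vertex) : ℕ := f.foldr (fun p m => 2 ^ code p ||| m) 0

theorem testBit_maskOf {f : List Vertex} {p : Vertex} : (maskOf f).testBit (code p) ↔ p ∈ f := by
  induction f with
  | nil => simp [maskOf]
  | cons q f ih =>
    have : maskOf (q :: f) = 2 ^ code q ||| maskOf f := rfl
    rw [this, Nat.testBit_or, Bool.or_eq_true, ih, Nat.testBit_two_pow, List.mem_cons,
      decide_eq_true_eq, code_injective.eq_iff, eq_comm]

/-- The facets of the cone with apex `r` over the octahedron `◇(p, q)`. -/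
def coneFacets (r : Vertex) (p q : Fin 3 → Vertex) : List (List Vertex) :=
  [true, false].flatMap fun e₀ => [true, false].flatMap fun e₁ => [true, false].map fun e₂ =>
    [r, if e₀ then p 0 else q 0, if e₁ then p 1 else q 1, if e₂ then p 2 else q 2]

/-- The facets of `Γ₂`. -/
def prismFacets : List (List Vertex) :=
  [[a 0, b 0, c 0, c 1], [a 0, b 0, b 1, c 1], [a 0, a 1, b 1, c 1],
    [a 1, b 1, c 1, c 2], [a 1, b 1, b 2, c 2], [a 1, a 2, b 2, c 2],
    [a 2, b 2, c 2, c 0], [a 2, b 2, b 0, c 0], [a 2, a 0, b 0, c 0]]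

theorem isFace_cone_iff_coneFacets {r : Vertex} {p q : Fin 3 → Vertex} {s : Finset Vertex} :
    IsFace (join (generatedBy {{r}}) (diamond p q)) s ↔
      ∃ f ∈ coneFacets r p q, ∀ t ∈ s, t ∈ f := by
  have hmem : ∀ (e : Fin 3 → Bool) t,
      t ∈ insert r (Finset.univ.image fun i => if e i then p i else q i) ↔
        t ∈ [r, if e 0 then p 0 else q 0, if e 1 then p 1 else q 1, if e 2 then p 2 else q 2] := by
    intro e t
    simp only [Finset.mem_insert, Finset.mem_image, Finset.mem_univ, true_and, Fin.exists_fin_succ,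
      List.mem_cons, eq_comm (a := t)]
    simp [Fin.succ_zero_eq_one]
  simp only [isFace_cone_diamond_iff, coneFacets, List.mem_flatMap, List.mem_map]
  constructor
  · rintro ⟨e, he⟩
    exact ⟨_, ⟨e 0, by cases e 0 <;> simp, e 1, by cases e 1 <;> simp, e 2,
      by cases e 2 <;> simp, rfl⟩, fun t ht => (hmem e t).1 (he ht)⟩
  · rintro ⟨f, ⟨e₀, -, e₁, -, e₂, -, rfl⟩, hf⟩
    exact ⟨![e₀, e₁, e₂], fun t ht => (hmem _ t).2 (hf t ht)⟩

theorem isFace_Gamma2_iff {s : Finset Vertex} :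
    IsFace Gamma2 s ↔ ∃ f ∈ prismFacets, ∀ t ∈ s, t ∈ f := by
  have hs : ∀ p q r t : Vertex, s ⊆ {p, q, r, t} ↔ ∀ w ∈ s, w ∈ [p, q, r, t] := fun p q r t =>
    forall₂_congr fun w _ => by simp
  rw [Gamma2, isFace_generatedBy_iff, prismFacets]
  simp only [Set.mem_insert_iff, Set.mem_singleton_iff, exists_eq_or_imp, exists_eq_left, hs,
    List.mem_cons, List.not_mem_nil, or_false]
  refine or_iff_right_of_imp ?_
  rintro rfl
  exact Or.inl (by simp)

/-- The facets of `Δ_{12,33}`. -/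
def facetLists : List (List Vertex) :=
  coneFacets (v 0) x y ++ coneFacets (v 1) y z ++ coneFacets (v 2) x ![z 2, z 0, z 1] ++
    prismFacets

theorem sameElements_facetLists : sameElements (facetLists.map maskOf) facetMasks = true := by
  decide +kernel

theorem isFace_Delta1233_iff {s : Finset Vertex} :
    IsFace Delta1233 s ↔ ∃ m ∈ facetMasks, ∀ p ∈ s, m.testBit (code p) := by
  have h : IsFace Delta1233 s ↔ ∃ f ∈ facetLists, ∀ t ∈ s, t ∈ f := by
    rw [Delta1233, Gamma1, isFace_sup_iff, isFace_sup_iff, isFace_sup_iff,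
      isFace_cone_iff_coneFacets, isFace_cone_iff_coneFacets, isFace_cone_iff_coneFacets,
      isFace_Gamma2_iff, facetLists]
    simp only [List.mem_append, or_and_right, exists_or]
  simp only [h, ← mem_iff_of_sameElements sameElements_facetLists, List.mem_map,
    exists_exists_and_eq_and, testBit_maskOf]

def codeFin (p : Vertex) : Fin 13 := ⟨code p, by unfold code; omega⟩

theorem codeFin_injective : Function.Injective codeFin := fun _ _ h =>
  code_injective (congrArg Fin.val h)

theorem exists_codeFin_eq : ∀ m ∈ facetMasks, ∀ j : Fin 13, m.testBit j → ∃ p, codeFin p = j := by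
  decide +kernel

theorem map_codeFin_Delta1233 : Delta1233.map codeFin = maskComplex 13 facetMasks := by
  refine map_eq_maskComplex (fun t => ?_) exists_codeFin_eq
  rw [isFace_Delta1233_iff]
  refine ⟨Or.inr, ?_⟩
  rintro (rfl | h)
  -- Any facet serves for the empty face; 57 is the first in the list.
  · exact ⟨57, by decide, by simp⟩
  · exact h

/-- The `0`-sphere. -/
def twoPoints : PreAbstractSimplicialComplex Bool := generatedBy {{false}, {true}}

theorem isFace_twoPoints_iff {s : Finset Bool} : IsFace twoPoints s ↔ ∃ e, s ⊆ {e} := by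
  rw [twoPoints, isFace_generatedBy_iff]
  constructor
  · rintro (rfl | ⟨f, rfl | rfl, hf⟩)
    · exact ⟨false, by simp⟩
    · exact ⟨false, hf⟩
    · exact ⟨true, hf⟩
  · rintro ⟨_ | _, he⟩
    · exact Or.inr ⟨_, Or.inl rfl, he⟩
    · exact Or.inr ⟨_, Or.inr rfl, he⟩

/-- The cone over two points is a pair of half-lines; splitting a real number into positive and
negative parts identifies it with the line. The 4-fold join is then the boundary of the
cross-polytope. -/
theorem coneHomeo_twoPoints : ConeHomeo twoPoints ℝ := by
  have hz : ∀ w ∈ coneSet twoPoints, w true = 0 ∨ w false = 0 := by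
    intro w hw
    obtain ⟨e, he⟩ := isFace_twoPoints_iff.1 hw.2
    by_contra! h
    have h1 := he (show true ∈ _ by simpa using h.1)
    have h2 := he (show false ∈ _ by simpa using h.2)
    rw [Finset.mem_singleton] at h1 h2
    exact absurd (h1.trans h2.symm) (by decide)
  refine ⟨fun w => w true - w false, fun t e => if e then max t 0 else max (-t) 0, by fun_prop,
    continuous_pi fun e => ?_, fun t => ⟨fun e => ?_, isFace_twoPoints_iff.2 ?_⟩, fun w hw => ?_,
    fun t => ?_, fun w hw => ?_⟩
  · cases e
    · simpa using (continuous_neg.max continuous_const : Continuous fun t : ℝ => max (-t) 0)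
    · simpa using (continuous_id.max continuous_const : Continuous fun t : ℝ => max t 0)
  · dsimp only
    split_ifs <;> exact le_max_right _ _
  · rcases le_total 0 t with h | h
    · refine ⟨true, fun e he => ?_⟩
      cases e
      · simp [h] at he
      · simp
    · refine ⟨false, fun e he => ?_⟩
      cases e
      · simp
      · simp [h] at he
  · have h1 := hw.1 true
    have h2 := hw.1 false
    ext e
    rcases hz w hw with h | h <;> cases e <;> simp [h, h1, h2]
  · rcases le_total 0 t with h | h <;> simp [h]
  · have h1 := hw.1 true
    have h2 := hw.1 false
    rcases hz w hw with h | h <;> simp [h, h1, h2]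

def crossPolytopeVertex (p : Fin 4 × Bool) : Fin 13 :=
  if p.2 then ![3, 4, 8, 5] p.1 else ![0, 1, 6, 2] p.1

theorem crossPolytopeVertex_injective : Function.Injective crossPolytopeVertex := by
  decide +kernel

theorem exists_mask_crossPolytope : ∀ e : Fin 4 → Bool, ∃ m ∈ crossPolytopeMasks,
    ∀ i, m.testBit (crossPolytopeVertex (i, e i)) := by
  decide +kernel

theorem signs_crossPolytope : ∀ m ∈ crossPolytopeMasks,
    (∀ p, m.testBit (crossPolytopeVertex p) →
      p.2 = m.testBit (crossPolytopeVertex (p.1, true))) ∧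
    ∀ j : Fin 13, m.testBit j → ∃ p, crossPolytopeVertex p = j := by
  decide +kernel

theorem map_crossPolytopeVertex :
    (joinPower 4 twoPoints).map crossPolytopeVertex = maskComplex 13 crossPolytopeMasks := by
  refine map_eq_maskComplex (fun t => ?_) fun m hm =>
    (signs_crossPolytope m hm).2
  simp only [isFace_joinPower_iff, isFace_twoPoints_iff]
  constructor
  · intro h
    choose e he using h
    obtain ⟨m, hm, hme⟩ := exists_mask_crossPolytope e
    refine Or.inr ⟨m, hm, ?_⟩
    rintro ⟨i, q⟩ hp
    obtain rfl : q = e i := Finset.mem_singleton.1 (he i (mem_slice.2 hp))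
    exact hme i
  · rintro (rfl | ⟨m, hm, h⟩)
    · exact fun i => ⟨false, fun q hq => by simp at hq⟩
    · have he := (signs_crossPolytope m hm).1
      exact fun i => ⟨m.testBit (crossPolytopeVertex (i, true)), fun q hq =>
        Finset.mem_singleton.2 (he (i, q) (h _ (mem_slice.1 hq)))⟩

theorem isSimplicialSphere_Delta1233 : IsSimplicialSphere 3 Delta1233 := by
  obtain ⟨e₁⟩ := nonempty_homeomorph_map Delta1233 codeFin_injective
  obtain ⟨e₂⟩ := nonempty_homeomorph_map (joinPower 4 twoPoints) crossPolytopeVertex_injective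
  obtain ⟨e₃⟩ := nonempty_homeomorph_of_checkFlips 12 checkFlips_flips
  obtain ⟨e₄⟩ := (coneHomeo_twoPoints.joinPower 4).nonempty_homeomorph_sphere
  obtain ⟨e₅⟩ := nonempty_homeomorph_sphere_of_finrank_eq (E := PiLp 1 fun _ : Fin 4 => ℝ)
    (F := EuclideanSpace ℝ (Fin (3 + 1))) (by
      rw [finrank_euclideanSpace_fin, (WithLp.linearEquiv 1 ℝ _).finrank_eq,
        Module.finrank_fin_fun])
  rw [map_codeFin_Delta1233] at e₁
  rw [map_crossPolytopeVertex] at e₂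
  exact ⟨e₁.symm.trans (e₃.trans (e₂.trans (e₄.trans e₅)))⟩

end FlagSphere

/-! ### Adjacency in the complex, and checks over all vertex subsets -/

namespace FlagSphere

section Graph

/-- The closed neighbourhoods of the vertices of `Δ_{12,33}`, as bit masks. -/
def neighborMasks : List ℕ :=
  [505, 4034, 3644, 1981, 3453, 2813, 3571, 3051, 2011, 4014, 3934, 3830]

def neighborMask (i : ℕ) : ℕ := neighborMasks.getD i 0

/-- Equality or adjacency in the `1`-skeleton of `Δ_{12,33}`. -/
def Adj (p q : Vertex) : Prop := (neighborMask (code p)).testBit (code q) = true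

instance (p q : Vertex) : Decidable (Adj p q) := inferInstanceAs (Decidable (_ = true))

theorem adj_refl : ∀ p, Adj p p := by decide +kernel

theorem adj_symm : ∀ p q, Adj p q → Adj q p := by decide +kernel

/-- A conjunction over all numbers `acc + m` with `m < 2 ^ n`. -/
def forallBits (P : ℕ → Bool) : ℕ → ℕ → Bool
  | 0, acc => P acc
  | n + 1, acc => forallBits P n acc && forallBits P n (acc + 2 ^ n)

theorem of_forallBits {P : ℕ → Bool} {n acc : ℕ} (h : forallBits P n acc = true) {m : ℕ}
    (hm : m < 2 ^ n) : P (acc + m) = true := by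
  induction n generalizing acc m with
  | zero => simpa [forallBits, Nat.lt_one_iff.1 hm] using h
  | succ n ih =>
    simp only [forallBits, Bool.and_eq_true] at h
    rcases lt_or_ge m (2 ^ n) with hlt | hge
    · exact ih h.1 hlt
    · have := ih h.2 (m := m - 2 ^ n) (by rw [pow_succ] at hm; omega)
      rwa [show acc + 2 ^ n + (m - 2 ^ n) = acc + m by omega] at this

theorem exists_code_eq : ∀ i < 12, ∃ p, code p = i := by decide

theorem code_lt (p : Vertex) : code p < 12 := by unfold code; omega

/-- Every set of vertices is given by a bit mask. -/
theorem exists_mask (s : Finset Vertex) :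
    ∃ m < 2 ^ 12, (∀ p, m.testBit (code p) = true ↔ p ∈ s) := by
  refine ⟨Nat.ofBits fun i : Fin 12 => decide (∃ p ∈ s, code p = i), Nat.ofBits_lt_two_pow _,
    fun p => ?_⟩
  rw [Nat.testBit_ofBits_lt _ _ (code_lt p), decide_eq_true_eq]
  exact ⟨fun ⟨q, hq, h⟩ => code_injective h ▸ hq, fun hp => ⟨p, hp, rfl⟩⟩

/-- The indices `i < 12` of the binary digits `1` of `m`. -/
def bitsBelow (m : ℕ) : List ℕ := (List.range 12).filter fun i => m.testBit i

/-- Flagness in mask form: a clique is contained in a facet. -/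
def checkClique (m : ℕ) : Bool :=
  !((bitsBelow m).all fun i => m &&& neighborMask i == m) || facetMasks.any fun f => m &&& f == m

theorem forallBits_checkClique : forallBits checkClique 12 0 = true := by
  decide +kernel

/-- `m &&& (m - 1)` clears the lowest binary digit 1, so the test passes when clearing twice, and no
fewer times, gives zero. -/
def hasTwoBits (m : ℕ) : Bool :=
  m != 0 && (m &&& (m - 1)) != 0 && (m &&& (m - 1)) &&& ((m &&& (m - 1)) - 1) == 0

/-- If the vertices of `m` induce a closed surface, they are the neighbours of a vertex. -/
def checkSurface (m : ℕ) : Bool :=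
  m == 0 || facetMasks.any (fun f => m &&& f == f) ||
    -- In a flag surface every vertex has a neighbour, and every edge has exactly two common
    -- neighbours of its endpoints. These necessary conditions already suffice to single out the
    -- vertex links.
    !((bitsBelow m).all fun i =>
      let mi := (m &&& neighborMask i) ^^^ 2 ^ i
      mi != 0 && (bitsBelow mi).all fun j => hasTwoBits ((mi &&& neighborMask j) ^^^ 2 ^ j)) ||
    (List.range 12).any fun i => m == neighborMask i ^^^ 2 ^ i

theorem forallBits_checkSurface : forallBits checkSurface 12 0 = true := by
  decide +kernel

/-- If the vertices of `m` contain a facet, and with each facet all adjacent facets, they are all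
vertices. -/
def checkClosed (m : ℕ) : Bool :=
  !(facetMasks.any fun f => m &&& f == f) || m == 4095 ||
    -- The fold computes the vertices of `m` equal or adjacent to every vertex of `f` other than
    -- `i`; it differs from `f` when that ridge has a second completion in `m`.
    !facetMasks.all fun f => m &&& f != f || (bitsBelow f).all fun i =>
      (bitsBelow f).foldr (fun j c => if j = i then c else c &&& neighborMask j) m != f

theorem forallBits_checkClosed : forallBits checkClosed 12 0 = true := by
  decide +kernel

theorem hasTwoBits_two_pow_or_two_pow :
    ∀ i < 12, ∀ j < 12, i ≠ j → hasTwoBits (2 ^ i ||| 2 ^ j) = true := by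
  decide +kernel

theorem adj_of_mem_facetMasks : ∀ m ∈ facetMasks, ∀ p q, m.testBit (code p) = true →
    m.testBit (code q) = true → Adj p q := by
  decide +kernel

theorem card_of_mem_facetMasks : ∀ m ∈ facetMasks,
    (Finset.univ.filter fun p => m.testBit (code p) = true).card = 4 := by
  decide +kernel

theorem facetMasks_lt : ∀ m ∈ facetMasks, m < 2 ^ 12 := by decide

theorem neighborMask_lt : ∀ i, neighborMask i < 2 ^ 12 := by
  intro i
  rcases lt_or_ge i 12 with hi | hi
  · revert i; decide
  · rw [neighborMask, List.getD_eq_default _ _ (by simpa [neighborMasks] using hi)]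
    norm_num

theorem exists_code_eq_of_testBit {m j : ℕ} (hm : m < 2 ^ 12) (h : m.testBit j = true) :
    ∃ p, code p = j := by
  refine exists_code_eq j ?_
  by_contra hj
  rw [Nat.testBit_lt_two_pow (hm.trans_le (Nat.pow_le_pow_right two_pos (not_lt.1 hj)))] at h
  exact Bool.false_ne_true h

theorem mask_eq_iff {m m' : ℕ} (hm : m < 2 ^ 12) (hm' : m' < 2 ^ 12) :
    m = m' ↔ ∀ p, m.testBit (code p) = true ↔ m'.testBit (code p) = true := by
  refine ⟨fun h p => by rw [h], fun h => Nat.eq_of_testBit_eq fun j => ?_⟩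
  by_cases hj : ∃ p, code p = j
  · obtain ⟨p, rfl⟩ := hj
    exact Bool.eq_iff_iff.2 (h p)
  · have h1 : m.testBit j ≠ true := fun h => hj (exists_code_eq_of_testBit hm h)
    have h2 : m'.testBit j ≠ true := fun h => hj (exists_code_eq_of_testBit hm' h)
    rw [Bool.eq_false_iff.2 h1, Bool.eq_false_iff.2 h2]

theorem and_eq_right_iff {m f : ℕ} (hf : f < 2 ^ 12) :
    m &&& f = f ↔ ∀ p, f.testBit (code p) = true → m.testBit (code p) = true := by
  rw [mask_eq_iff (Nat.and_le_right.trans_lt hf) hf]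
  simp only [Nat.testBit_and, Bool.and_eq_true, and_iff_right_iff_imp]

theorem mem_bitsBelow_iff {m i : ℕ} : i ∈ bitsBelow m ↔ i < 12 ∧ m.testBit i = true := by
  simp [bitsBelow]

theorem testBit_foldr_and {l : List ℕ} {i m t : ℕ} :
    (l.foldr (fun j c => if j = i then c else c &&& neighborMask j) m).testBit t = true ↔
      m.testBit t = true ∧ ∀ j ∈ l, j ≠ i → (neighborMask j).testBit t = true := by
  induction l with
  | nil => simp
  | cons j l ih =>
    rw [List.foldr_cons]
    by_cases hj : j = i
    · simp [hj, ih]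
    · simp only [if_neg hj, Nat.testBit_and, Bool.and_eq_true, ih, List.mem_cons, forall_eq_or_imp]
      tauto

/-- `Δ_{12,33}` is the clique complex of its `1`-skeleton. -/
theorem isFace_Delta1233_iff_adj {s : Finset Vertex} :
    IsFace Delta1233 s ↔ ∀ p ∈ s, ∀ q ∈ s, Adj p q := by
  rw [isFace_Delta1233_iff]
  constructor
  · rintro ⟨m, hm, hs⟩ p hp q hq
    exact adj_of_mem_facetMasks m hm p q (hs p hp) (hs q hq)
  · intro h
    obtain ⟨m, hm, hms⟩ := exists_mask s
    have hc := of_forallBits forallBits_checkClique hm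
    rw [zero_add, checkClique, Bool.or_eq_true, Bool.not_eq_true'] at hc
    rcases hc with hc | hc
    · rw [List.all_eq_false] at hc
      obtain ⟨i, hi, hne⟩ := hc
      obtain ⟨p, rfl⟩ := exists_code_eq i (mem_bitsBelow_iff.1 hi).1
      have hp := (hms p).1 (mem_bitsBelow_iff.1 hi).2
      refine absurd ?_ hne
      rw [beq_iff_eq, Nat.and_comm, and_eq_right_iff hm]
      exact fun q hq => h p hp q ((hms q).1 hq)
    · rw [List.any_eq_true] at hc
      obtain ⟨f, hf, hfm⟩ := hc
      rw [beq_iff_eq, Nat.and_comm, and_eq_right_iff hm] at hfm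
      exact ⟨f, hf, fun p hp => hfm p ((hms p).2 hp)⟩

end Graph

/-! ### Induced closed pseudomanifolds in a single copy -/

section Pseudomanifold

variable {V : Type*}

theorem isFace_empty (K : PreAbstractSimplicialComplex V) : IsFace K ∅ := Or.inl rfl

theorem isFace_induced_iff {K : PreAbstractSimplicialComplex V} {W s : Finset V} :
    IsFace (induced K W) s ↔ IsFace K s ∧ s ⊆ W := by
  constructor
  · rintro (rfl | h)
    · exact ⟨isFace_empty K, Finset.empty_subset W⟩
    · exact ⟨Or.inr h.1, h.2⟩
  · rintro ⟨rfl | h, hW⟩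
    · exact isFace_empty _
    · exact Or.inr ⟨h, hW⟩

variable [DecidableEq V]

theorem exists_maximal_face [Finite V] {K : PreAbstractSimplicialComplex V} {s : Finset V}
    (hs : IsFace K s) : ∃ t, s ⊆ t ∧ IsFace K t ∧ ∀ p ∉ t, ¬ IsFace K (insert p t) := by
  obtain ⟨t, hst, ht⟩ := (Set.toFinite {t | IsFace K t}).exists_le_maximal hs
  exact ⟨t, hst, ht.1, fun p hp hpt => hp (ht.2 hpt (Finset.subset_insert p t)
    (Finset.mem_insert_self p t))⟩

theorem IsClosedPseudomanifold.card_le [Finite V] {n : ℕ} {K : PreAbstractSimplicialComplex V}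
    (h : IsClosedPseudomanifold n K) {s : Finset V} (hs : IsFace K s) : s.card ≤ n := by
  obtain ⟨t, hst, ht, hmax⟩ := exists_maximal_face hs
  exact (Finset.card_le_card hst).trans (h.1 t ht hmax).le

theorem IsClosedPseudomanifold.exists_insert {n : ℕ} {K : PreAbstractSimplicialComplex V}
    (h : IsClosedPseudomanifold n K) {s : Finset V} (hs : IsFace K s) (hn : s.card ≠ n) :
    ∃ p ∉ s, IsFace K (insert p s) := by
  by_contra! hmax
  exact hn (h.1 s hs hmax)

end Pseudomanifold

theorem isFace_insert_Delta1233_iff {s : Finset Vertex} {p : Vertex} :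
    IsFace Delta1233 (insert p s) ↔ IsFace Delta1233 s ∧ ∀ q ∈ s, Adj p q := by
  simp only [isFace_Delta1233_iff_adj, Finset.mem_insert, forall_eq_or_imp, adj_refl, true_and]
  constructor
  · rintro ⟨h1, h2⟩
    exact ⟨fun q hq => (h2 q hq).2, h1⟩
  · rintro ⟨h1, h2⟩
    exact ⟨h2, fun q hq => ⟨adj_symm p q (h2 q hq), h1 q hq⟩⟩

/-- An induced closed surface in `Δ_{12,33}` is the link of a vertex. -/
theorem exists_forall_mem_iff_of_isClosedPseudomanifold_three {W : Finset Vertex}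
    (h : IsClosedPseudomanifold 3 (induced Delta1233 W)) :
    ∃ p, ∀ q, q ∈ W ↔ q ≠ p ∧ Adj p q := by
  obtain ⟨m, hm, hmW⟩ := exists_mask W
  have hbit : ∀ (c : ℕ) (p q : Vertex), (c ^^^ 2 ^ code p).testBit (code q) =
      (c.testBit (code q) ^^ decide (q = p)) := fun c p q => by
    rw [Nat.testBit_xor, Nat.testBit_two_pow]
    simp only [code_injective.eq_iff, eq_comm]
  have hnbr : ∀ (c : ℕ) (p q : Vertex), c.testBit (code p) = true →
      (((c &&& neighborMask (code p)) ^^^ 2 ^ code p).testBit (code q) = true ↔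
        c.testBit (code q) = true ∧ Adj p q ∧ q ≠ p) := fun c p q hp => by
    rw [hbit, Nat.testBit_and]
    by_cases hqp : q = p
    · subst hqp
      have : (neighborMask (code q)).testBit (code q) = true := adj_refl q
      simp [hp, this]
    · simp [hqp, Adj]
  have hc := of_forallBits forallBits_checkSurface hm
  simp only [zero_add, checkSurface, Bool.or_eq_true, Bool.not_eq_true', beq_iff_eq,
    List.any_eq_true, List.mem_range] at hc
  rcases hc with ((rfl | ⟨f, hf, hfm⟩) | hc) | ⟨i, hi, rfl⟩
  · obtain ⟨p, -, hp⟩ := h.exists_insert (isFace_empty _) (by simp)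
    have := (hmW p).2 ((isFace_induced_iff.1 hp).2 (Finset.mem_insert_self _ _))
    simp at this
  · exfalso
    -- A full facet in `W` would be a face with four vertices, too large for a surface.
    rw [and_eq_right_iff (facetMasks_lt f hf)] at hfm
    have hle := h.card_le (s := Finset.univ.filter fun p => f.testBit (code p) = true)
      (isFace_induced_iff.2 ⟨isFace_Delta1233_iff.2 ⟨f, hf, fun p hp => (Finset.mem_filter.1 hp).2⟩,
        fun p hp => (hmW p).1 (hfm p (Finset.mem_filter.1 hp).2)⟩)
    rw [card_of_mem_facetMasks f hf] at hle
    omega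
  · exfalso
    rw [List.all_eq_false] at hc
    obtain ⟨i, hi, hne⟩ := hc
    obtain ⟨p, rfl⟩ := exists_code_eq i (mem_bitsBelow_iff.1 hi).1
    have hpm := (mem_bitsBelow_iff.1 hi).2
    have hpW := (hmW p).1 hpm
    have hfp : IsFace (induced Delta1233 W) {p} := isFace_induced_iff.2
      ⟨isFace_Delta1233_iff_adj.2 (by simp [adj_refl]), by simpa using hpW⟩
    refine hne ?_
    simp only [Bool.and_eq_true, bne_iff_ne, List.all_eq_true]
    constructor
    · obtain ⟨q, hqp, hq⟩ := h.exists_insert hfp (by simp)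
      obtain ⟨hq, hqW⟩ := isFace_induced_iff.1 hq
      have hqm := (hmW q).2 (hqW (Finset.mem_insert_self _ _))
      have hadj := adj_symm _ _ ((isFace_insert_Delta1233_iff.1 hq).2 p (Finset.mem_singleton_self p))
      intro h0
      have := (hnbr m p q hpm).2 ⟨hqm, hadj, by simpa using hqp⟩
      rw [h0] at this
      simp at this
    · intro j hj
      obtain ⟨q, rfl⟩ := exists_code_eq j (mem_bitsBelow_iff.1 hj).1
      have hqmi := (mem_bitsBelow_iff.1 hj).2
      obtain ⟨hqm, hpq, hqp⟩ := (hnbr m p q hpm).1 hqmi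
      have hfqp : IsFace (induced Delta1233 W) {q, p} := isFace_induced_iff.2
        ⟨isFace_insert_Delta1233_iff.2 ⟨(isFace_induced_iff.1 hfp).1, by
          simpa using adj_symm _ _ hpq⟩, by
          simp [Finset.insert_subset_iff, hpW, (hmW q).1 hqm]⟩
      -- By flagness the third vertices of the two triangles on this edge are precisely the common
      -- neighbours of `p` and `q` in `W`.
      obtain ⟨q₁, q₂, hne12, hq12⟩ := h.2 {q, p} hfqp (by rw [Finset.card_pair hqp])
      have heq : ((m &&& neighborMask (code p)) ^^^ 2 ^ code p) &&& neighborMask (code q) ^^^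
          2 ^ code q = 2 ^ code q₁ ||| 2 ^ code q₂ := by
        have hp2 : ∀ r, 2 ^ code r < 2 ^ 12 := fun r =>
          Nat.pow_lt_pow_right (by norm_num) (code_lt r)
        rw [mask_eq_iff
          (Nat.xor_lt_two_pow (Nat.and_lt_two_pow _ (neighborMask_lt _)) (hp2 q))
          (Nat.or_lt_two_pow (hp2 q₁) (hp2 q₂))]
        intro r
        rw [hnbr _ q r hqmi, hnbr m p r hpm, Nat.testBit_or, Bool.or_eq_true, Nat.testBit_two_pow,
          Nat.testBit_two_pow, decide_eq_true_eq, decide_eq_true_eq, code_injective.eq_iff,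
          code_injective.eq_iff, eq_comm (a := q₁), eq_comm (a := q₂), ← hq12 r,
          isFace_induced_iff, isFace_insert_Delta1233_iff, Finset.insert_subset_iff, ← hmW r]
        have h1 := isFace_induced_iff.1 hfqp
        simp only [h1.1, h1.2, true_and, and_true, Finset.mem_insert, Finset.mem_singleton,
          forall_eq_or_imp, forall_eq, not_or]
        constructor
        · rintro ⟨⟨h1, h2, h3⟩, h4, h5⟩
          exact ⟨⟨h5, h3⟩, ⟨adj_symm _ _ h4, adj_symm _ _ h2⟩, h1⟩
        · rintro ⟨⟨h5, h3⟩, ⟨h4, h2⟩, h1⟩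
          exact ⟨⟨h1, adj_symm _ _ h2, h3⟩, adj_symm _ _ h4, h5⟩
      rw [heq]
      exact hasTwoBits_two_pow_or_two_pow _ (code_lt q₁) _ (code_lt q₂)
        fun h => hne12 (code_injective h)
  · obtain ⟨p, rfl⟩ := exists_code_eq i hi
    refine ⟨p, fun q => ?_⟩
    rw [← hmW q, hbit]
    by_cases hqp : q = p
    · subst hqp
      have : (neighborMask (code q)).testBit (code q) = true := adj_refl q
      simp [this]
    · simp [hqp, Adj]

theorem eq_univ_of_isClosedPseudomanifold_four {W : Finset Vertex}
    (h : IsClosedPseudomanifold 4 (induced Delta1233 W)) : W = Finset.univ := by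
  obtain ⟨m, hm, hmW⟩ := exists_mask W
  have hc := of_forallBits forallBits_checkClosed hm
  simp only [zero_add, checkClosed, Bool.or_eq_true, Bool.not_eq_true', beq_iff_eq] at hc
  rcases hc with (hc | rfl) | hc
  · exfalso
    obtain ⟨s, -, hs, hmax⟩ := exists_maximal_face (isFace_empty (induced Delta1233 W))
    have hcard := h.1 s hs hmax
    obtain ⟨hs, hsW⟩ := isFace_induced_iff.1 hs
    obtain ⟨f, hf, hsf⟩ := isFace_Delta1233_iff.1 hs
    -- A maximal face of the induced complex has four vertices, so it equals a facet of `Delta1233`,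
    -- and `W` contains a facet.
    have hseq : s = Finset.univ.filter fun p => f.testBit (code p) = true :=
      Finset.eq_of_subset_of_card_le (fun p hp => by simpa using hsf p hp)
        (by rw [card_of_mem_facetMasks f hf, hcard])
    rw [List.any_eq_false] at hc
    refine hc f hf ?_
    rw [beq_iff_eq, and_eq_right_iff (facetMasks_lt f hf)]
    intro p hp
    refine (hmW p).2 (hsW ?_)
    rw [hseq]
    simpa using hp
  · ext p
    rw [← hmW p]
    refine ⟨fun _ => Finset.mem_univ p, fun _ => ?_⟩
    revert p
    decide
  · exfalso
    rw [List.all_eq_false] at hc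
    obtain ⟨f, hf, hne⟩ := hc
    refine hne ?_
    rw [Bool.or_eq_true]
    by_cases hfm : m &&& f = f
    swap
    · exact Or.inl (by simpa using hfm)
    right
    rw [and_eq_right_iff (facetMasks_lt f hf)] at hfm
    rw [List.all_eq_true]
    intro i hi
    obtain ⟨p, rfl⟩ := exists_code_eq i (mem_bitsBelow_iff.1 hi).1
    have hpf := (mem_bitsBelow_iff.1 hi).2
    set S := Finset.univ.filter fun p => f.testBit (code p) = true with hS
    have hSmem : ∀ q, q ∈ S ↔ f.testBit (code q) = true := fun q => by simp [hS]
    have hpS : p ∈ S := (hSmem p).2 hpf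
    have hSf : IsFace (induced Delta1233 W) S := isFace_induced_iff.2
      ⟨isFace_Delta1233_iff.2 ⟨f, hf, fun q hq => (hSmem q).1 hq⟩,
        fun q hq => (hmW q).1 (hfm q ((hSmem q).1 hq))⟩
    -- One of the two completions of this ridge is `p`; the other supplies the vertex of `W` across
    -- it.
    obtain ⟨q₁, q₂, hne12, hq12⟩ := h.2 (S.erase p) (hSf.mono (Finset.erase_subset p S)) (by
      rw [Finset.card_erase_of_mem hpS, card_of_mem_facetMasks f hf])
    have hp := (hq12 p).1 ⟨Finset.notMem_erase p S, by rwa [Finset.insert_erase hpS]⟩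
    obtain ⟨q, hqp, hq⟩ : ∃ q, q ≠ p ∧ (q = q₁ ∨ q = q₂) := by
      rcases hp with rfl | rfl
      · exact ⟨q₂, hne12.symm, Or.inr rfl⟩
      · exact ⟨q₁, hne12, Or.inl rfl⟩
    obtain ⟨hqS, hqf⟩ := (hq12 q).2 hq
    obtain ⟨hqf, hqW⟩ := isFace_induced_iff.1 hqf
    have hqm := (hmW q).2 (hqW (Finset.mem_insert_self _ _))
    rw [bne_iff_ne]
    intro heq
    refine hqS (Finset.mem_erase.2 ⟨hqp, (hSmem q).2 ?_⟩)
    rw [← heq, testBit_foldr_and]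
    refine ⟨hqm, fun j hj hjp => ?_⟩
    obtain ⟨r, rfl⟩ := exists_code_eq j (mem_bitsBelow_iff.1 hj).1
    refine adj_symm q r ((isFace_insert_Delta1233_iff.1 hqf).2 r (Finset.mem_erase.2 ⟨?_, ?_⟩))
    · exact fun h => hjp (h ▸ rfl)
    · exact (hSmem r).2 (mem_bitsBelow_iff.1 hj).2

end FlagSphere

/-! ### Factors of a join that is a closed pseudomanifold -/

namespace FlagSphere

section Join

variable {ι V : Type*} [Fintype ι] [DecidableEq ι] [DecidableEq V]

/-- The set whose part in the `i`-th copy of `V` is `F i`. -/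
def glue (F : ι → Finset V) : Finset (ι × V) :=
  Finset.univ.biUnion fun i => (F i).image (Prod.mk i)

theorem mem_glue {F : ι → Finset V} {q : ι × V} : q ∈ glue F ↔ q.2 ∈ F q.1 := by
  obtain ⟨i, p⟩ := q
  simp [glue]

theorem card_glue (F : ι → Finset V) : (glue F).card = ∑ i, (F i).card := by
  rw [glue, Finset.card_biUnion]
  · exact Finset.sum_congr rfl fun i _ =>
      Finset.card_image_of_injective _ (Prod.mk_right_injective i)
  · intro i _ j _ hij
    rw [Function.onFun, Finset.disjoint_left]
    intro q hq hq'
    obtain ⟨p, -, rfl⟩ := Finset.mem_image.1 hq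
    obtain ⟨p', -, h⟩ := Finset.mem_image.1 hq'
    exact hij (congrArg Prod.fst h).symm

theorem slice_glue (F : ι → Finset V) (i : ι) : slice (glue F) i = F i := by
  ext p; simp [mem_glue]

theorem slice_insert_self {ι V : Type*} [DecidableEq ι] [DecidableEq V] (s : Finset (ι × V))
    (i : ι) (p : V) : slice (insert (i, p) s) i = insert p (slice s i) := by
  ext q; simp

theorem slice_insert_of_ne {ι V : Type*} [DecidableEq ι] [DecidableEq V] (s : Finset (ι × V))
    {i j : ι} (h : j ≠ i) (p : V) : slice (insert (i, p) s) j = slice s j := by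
  ext q; simp [h]

/-- The factors of a join which is a closed pseudomanifold are closed pseudomanifolds. -/
theorem IsClosedPseudomanifold.exists_of_join [Finite V] {n : ℕ}
    {E : PreAbstractSimplicialComplex (ι × V)} {C : ι → PreAbstractSimplicialComplex V}
    (hE : ∀ s, IsFace E s ↔ ∀ i, IsFace (C i) (slice s i)) (h : IsClosedPseudomanifold n E) :
    ∃ d : ι → ℕ, ∑ i, d i = n ∧ ∀ i, IsClosedPseudomanifold (d i) (C i) := by
  -- A facet is fixed in every factor; replacing only the `i`-th one by a face `t` transfers the
  -- hypothesis on the join to `C i`.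
  choose m _ hm hmax using fun i => exists_maximal_face (isFace_empty (C i))
  have hglue : ∀ F : ι → Finset V, (∀ i, IsFace (C i) (F i)) → IsFace E (glue F) := fun F hF =>
    (hE _).2 fun i => by rw [slice_glue]; exact hF i
  have hinsert : ∀ (F : ι → Finset V), (∀ i, IsFace (C i) (F i)) → ∀ i p,
      IsFace E (insert (i, p) (glue F)) ↔ IsFace (C i) (insert p (F i)) := by
    intro F hF i p
    rw [hE]
    constructor
    · intro h
      have := h i
      rwa [slice_insert_self, slice_glue] at this
    · intro h j
      by_cases hj : j = i
      · subst hj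
        rwa [slice_insert_self, slice_glue]
      · rw [slice_insert_of_ne _ hj, slice_glue]
        exact hF j
  have hcard : ∀ F : ι → Finset V, (∀ i, IsFace (C i) (F i)) →
      (∀ i, ∀ p ∉ F i, ¬ IsFace (C i) (insert p (F i))) → ∑ i, (F i).card = n := by
    intro F hF hFmax
    rw [← card_glue]
    refine h.1 _ (hglue F hF) ?_
    rintro ⟨i, p⟩ hp hf
    exact hFmax i p (fun h => hp (mem_glue.2 h)) ((hinsert F hF i p).1 hf)
  have hupd : ∀ i t, IsFace (C i) t → ∀ j, IsFace (C j) (Function.update m i t j) := by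
    intro i t ht j
    by_cases hj : j = i
    · subst hj; simpa using ht
    · simpa [hj] using hm j
  have hsum : ∀ i t, ∑ j, (Function.update m i t j).card + (m i).card =
      ∑ j, (m j).card + t.card := by
    intro i t
    rw [← Finset.add_sum_erase _ _ (Finset.mem_univ i),
      ← Finset.add_sum_erase _ (fun j => (m j).card) (Finset.mem_univ i), Function.update_self]
    have : ∑ j ∈ Finset.univ.erase i, (Function.update m i t j).card =
        ∑ j ∈ Finset.univ.erase i, (m j).card :=
      Finset.sum_congr rfl fun j hj => by rw [Function.update_of_ne (Finset.ne_of_mem_erase hj)]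
    omega
  have hmn := hcard m hm hmax
  refine ⟨fun i => (m i).card, hmn, fun i => ⟨fun t ht htmax => ?_, fun t ht htc => ?_⟩⟩
  · have h1 := hcard (Function.update m i t) (hupd i t ht) (fun j => by
      by_cases hj : j = i
      · subst hj; simpa using htmax
      · simpa [hj] using hmax j)
    have h2 := hsum i t
    change t.card = (m i).card
    omega
  · have h2 := hsum i t
    change t.card + 1 = (m i).card at htc
    obtain ⟨⟨j₁, p₁⟩, ⟨j₂, p₂⟩, hne, hq⟩ := h.2 (glue (Function.update m i t))
      (hglue _ (hupd i t ht)) (by rw [card_glue]; omega)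
    -- The other parts are maximal, so both completions of the glued ridge lie in the `i`-th copy.
    have hin : ∀ j p, (j, p) ∉ glue (Function.update m i t) →
        IsFace E (insert (j, p) (glue (Function.update m i t))) → j = i := by
      intro j p hp hf
      by_contra hj
      rw [hinsert _ (hupd i t ht)] at hf
      rw [mem_glue] at hp
      simp only [Function.update_of_ne hj] at hf hp
      exact hmax j p hp hf
    have h₁ := (hq (j₁, p₁)).2 (Or.inl rfl)
    have h₂ := (hq (j₂, p₂)).2 (Or.inr rfl)
    obtain rfl := hin j₁ p₁ h₁.1 h₁.2
    obtain rfl := hin j₂ p₂ h₂.1 h₂.2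
    refine ⟨p₁, p₂, fun h => hne (by rw [h]), fun p => ?_⟩
    have := hq (j₂, p)
    rw [hinsert _ (hupd j₂ t ht), mem_glue] at this
    simpa using this

end Join

/-! ### Flagness, suspensions, contractible edges and equators of the join -/

section JoinPower

variable {k : ℕ}

theorem isFace_joinPower_Delta1233_iff {s : Finset (Fin k × Vertex)} :
    IsFace (joinPower k Delta1233) s ↔ ∀ q ∈ s, ∀ r ∈ s, q.1 = r.1 → Adj q.2 r.2 := by
  simp only [isFace_joinPower_iff, isFace_Delta1233_iff_adj, mem_slice]
  constructor
  · rintro h ⟨i, p⟩ hp ⟨j, q⟩ hq rfl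
    exact h _ p hp q hq
  · exact fun h i p hp q hq => h _ hp _ hq rfl

theorem isFace_pair_iff {q r : Fin k × Vertex} :
    IsFace (joinPower k Delta1233) {q, r} ↔ (q.1 = r.1 → Adj q.2 r.2) := by
  rw [isFace_joinPower_Delta1233_iff]
  constructor
  · exact fun h => h q (by simp) r (by simp)
  · intro h
    simp only [Finset.mem_insert, Finset.mem_singleton, forall_eq_or_imp, forall_eq]
    exact ⟨⟨fun _ => adj_refl _, h⟩, fun h' => adj_symm _ _ (h h'.symm), fun _ => adj_refl _⟩

theorem isFace_singleton (q : Fin k × Vertex) : IsFace (joinPower k Delta1233) {q} := by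
  simp [isFace_joinPower_Delta1233_iff, adj_refl]

theorem isFlag_joinPower_Delta1233 : IsFlag (joinPower k Delta1233) := by
  intro F hF hmin
  rw [isFace_joinPower_Delta1233_iff] at hF
  push Not at hF
  obtain ⟨q, hq, r, hr, hqr, hadj⟩ := hF
  have hne : q ≠ r := fun h => hadj (h ▸ adj_refl _)
  have hsub : {q, r} ⊆ F := by simp [Finset.insert_subset_iff, hq, hr]
  have heq : {q, r} = F := by
    by_contra hne'
    exact hadj (isFace_pair_iff.1 (hmin _ (hsub.ssubset_of_ne hne')) hqr)
  rw [← heq, Finset.card_pair hne]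

theorem exists_ne_ne_not_adj : ∀ p r, ∃ q, q ≠ p ∧ q ≠ r ∧ ¬ Adj q p := by
  decide +kernel

/-- An apex of a suspension is adjacent to every vertex except the opposite apex, but within its own
copy it misses at least two vertices. -/
theorem not_isSuspension_joinPower_Delta1233 : ¬ IsSuspension (joinPower k Delta1233) := by
  rintro ⟨L, ⟨i, p⟩, b, -, -, -, hK⟩
  obtain ⟨q, hqp, hqb, hadj⟩ := exists_ne_ne_not_adj p b.2
  have hq := isFace_singleton (i, q)
  rw [hK, isFace_join_iff] at hq
  obtain ⟨F, G, hF, hG, hFG⟩ := hq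
  have hGsub : G ⊆ {(i, q)} := hFG ▸ Finset.subset_union_right
  have hG0 : G = ∅ := by
    by_contra hne
    have hGq := (Finset.subset_singleton_iff.1 hGsub).resolve_left hne
    rcases isFace_generatedBy_iff.1 hG with h | ⟨f, hf, hGf⟩
    · exact hne h
    · rw [hGq, Finset.singleton_subset_iff] at hGf
      rcases hf with rfl | rfl
      · exact hqp (congrArg Prod.snd (Finset.mem_singleton.1 hGf))
      · exact hqb (congrArg Prod.snd (Finset.mem_singleton.1 hGf))
  rw [hG0, Finset.union_empty] at hFG
  have : IsFace (joinPower k Delta1233) {(i, q), (i, p)} := by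
    rw [hK, isFace_join_iff]
    exact ⟨F, {(i, p)}, hF, isFace_generatedBy_iff.2 (Or.inr ⟨_, Or.inl rfl, subset_rfl⟩),
      by rw [← hFG]; rfl⟩
  exact hadj (isFace_pair_iff.1 this rfl)

theorem isInducedFourCycle_of_isFace {V : Type*} [DecidableEq V]
    {K : PreAbstractSimplicialComplex V} {a b c d : V} (hnd : [a, b, c, d].Nodup)
    (hab : IsFace K {a, b}) (hbc : IsFace K {b, c}) (hcd : IsFace K {c, d}) (hda : IsFace K {d, a})
    (hac : ¬ IsFace K {a, c}) (hbd : ¬ IsFace K {b, d}) :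
    IsInducedFourCycle K {a, b, c, d} := by
  refine ⟨a, b, c, d, hnd, rfl, ext_isFace fun s => ?_⟩
  rw [isFace_induced_iff, isFace_generatedBy_iff]
  simp only [Set.mem_insert_iff, Set.mem_singleton_iff, exists_eq_or_imp, exists_eq_left]
  constructor
  · rintro ⟨hs, hsub⟩
    have h1 : ¬ (a ∈ s ∧ c ∈ s) := fun h => hac (hs.mono (by
      simp [Finset.insert_subset_iff, h]))
    have h2 : ¬ (b ∈ s ∧ d ∈ s) := fun h => hbd (hs.mono (by
      simp [Finset.insert_subset_iff, h]))
    have hmem : ∀ p ∈ s, p = a ∨ p = b ∨ p = c ∨ p = d := fun p hp => by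
      simpa using hsub hp
    right
    by_cases ha : a ∈ s <;> by_cases hb : b ∈ s
    · refine Or.inl fun p hp => ?_
      rcases hmem p hp with rfl | rfl | rfl | rfl <;> simp_all
    · refine Or.inr (Or.inr (Or.inr fun p hp => ?_))
      rcases hmem p hp with rfl | rfl | rfl | rfl <;> simp_all
    · refine Or.inr (Or.inl fun p hp => ?_)
      rcases hmem p hp with rfl | rfl | rfl | rfl <;> simp_all
    · refine Or.inr (Or.inr (Or.inl fun p hp => ?_))
      rcases hmem p hp with rfl | rfl | rfl | rfl <;> simp_all
  · rintro (rfl | h | h | h | h)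
    · exact ⟨isFace_empty K, Finset.empty_subset _⟩
    · exact ⟨hab.mono h, h.trans fun p hp => by simp at hp ⊢; tauto⟩
    · exact ⟨hbc.mono h, h.trans fun p hp => by simp at hp ⊢; tauto⟩
    · exact ⟨hcd.mono h, h.trans fun p hp => by simp at hp ⊢; tauto⟩
    · exact ⟨hda.mono h, h.trans fun p hp => by simp at hp ⊢; tauto⟩

theorem exists_four_cycle : ∀ p q, p ≠ q → Adj p q → ∃ r, r ≠ q ∧ Adj q r ∧ ¬ Adj p r ∧
    ∃ s, s ≠ r ∧ s ≠ p ∧ Adj r s ∧ Adj s p ∧ ¬ Adj q s := by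
  decide +kernel

theorem not_isContractibleEdge_joinPower_Delta1233 (e : Finset (Fin k × Vertex)) :
    ¬ IsContractibleEdge (joinPower k Delta1233) e := by
  rintro ⟨heK, hcard, hno⟩
  obtain ⟨⟨i, p⟩, ⟨j, q⟩, hne, rfl⟩ := Finset.card_eq_two.1 hcard
  obtain ⟨c, d, hnd, hbc, hcd, hda, hac, hbd⟩ : ∃ c d : Fin k × Vertex,
      [(i, p), (j, q), c, d].Nodup ∧ IsFace (joinPower k Delta1233) {(j, q), c} ∧
      IsFace (joinPower k Delta1233) {c, d} ∧ IsFace (joinPower k Delta1233) {d, (i, p)} ∧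
      ¬ IsFace (joinPower k Delta1233) {(i, p), c} ∧
      ¬ IsFace (joinPower k Delta1233) {(j, q), d} := by
    simp only [isFace_pair_iff]
    by_cases hij : i = j
    · subst hij
      have hpq : p ≠ q := fun h => hne (by rw [h])
      obtain ⟨r, h1, h2, h3, s, h4, h5, h6, h7, h8⟩ := exists_four_cycle p q hpq
        (isFace_pair_iff.1 (Or.inr heK) rfl)
      have h9 : p ≠ r := fun h => h3 (h ▸ adj_refl _)
      have h10 : q ≠ s := fun h => h8 (h ▸ adj_refl _)
      refine ⟨(i, r), (i, s), ?_, ?_⟩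
      · simp [hpq, h9, h10, h5.symm, h1.symm, h4.symm]
      · simp [h2, h3, h6, h7, h8]
    -- Endpoints in different copies: a non-neighbour of each, taken in its own copy, gives a join
    -- of two pairs of non-adjacent vertices, which is an induced 4-cycle.
    · obtain ⟨r, h1, -, h2⟩ := exists_ne_ne_not_adj p p
      obtain ⟨s, h3, -, h4⟩ := exists_ne_ne_not_adj q q
      refine ⟨(i, r), (j, s), ?_, ?_⟩
      · simp [hij, Ne.symm hij, h1.symm, h3.symm]
      · have h2' : ¬ Adj p r := fun h => h2 (adj_symm _ _ h)
        have h4' : ¬ Adj q s := fun h => h4 (adj_symm _ _ h)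
        simp [hij, Ne.symm hij, h2', h4']
  exact hno ⟨_, isInducedFourCycle_of_isFace hnd (Or.inr heK) hbc hcd hda hac hbd,
    by simp [Finset.insert_subset_iff]⟩

/-- The defects `4 - d i` are non-negative with sum 1, so exactly one of them is nonzero. -/
theorem exists_eq_three_of_sum_eq {d : Fin k → ℕ} (hd : ∀ i, d i ≤ 4)
    (hsum : ∑ i, d i + 1 = 4 * k) : ∃ j, d j = 3 ∧ ∀ i, i ≠ j → d i = 4 := by
  have h : ∑ i, (4 - d i) = 1 := by
    have : ∑ i, (4 - d i) + ∑ i, d i = 4 * k := by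
      rw [← Finset.sum_add_distrib, Finset.sum_congr rfl fun i _ => Nat.sub_add_cancel (hd i)]
      simp [mul_comm]
    omega
  obtain ⟨j, -, hj⟩ : ∃ j ∈ Finset.univ, 4 - d j ≠ 0 := by
    by_contra! h0
    rw [Finset.sum_eq_zero h0] at h
    exact zero_ne_one h
  rw [← Finset.add_sum_erase _ _ (Finset.mem_univ j)] at h
  refine ⟨j, by omega, fun i hi => ?_⟩
  have h0 : ∑ i ∈ Finset.univ.erase j, (4 - d i) = 0 := by omega
  have := Finset.sum_eq_zero_iff.1 h0 i (Finset.mem_erase.2 ⟨hi, Finset.mem_univ i⟩)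
  have := hd i
  omega

theorem isVertexLink_of_isClosedPseudomanifold {W : Finset (Fin k × Vertex)} (hk : 1 ≤ k)
    (h : IsClosedPseudomanifold (4 * k - 1) (induced (joinPower k Delta1233) W)) :
    IsVertexLink (joinPower k Delta1233) (induced (joinPower k Delta1233) W) := by
  obtain ⟨d, hsum, hd⟩ := h.exists_of_join (C := fun i => induced Delta1233 (slice W i))
    fun s => by
      simp only [isFace_induced_iff, isFace_joinPower_iff, forall_and, and_congr_right_iff]
      refine fun _ => ⟨fun h i p hp => mem_slice.2 (h (mem_slice.1 hp)), fun h q hq => ?_⟩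
      exact mem_slice.1 (h q.1 (mem_slice.2 hq))
  have hd4 : ∀ i, d i ≤ 4 := by
    intro i
    obtain ⟨s, -, hs, hmax⟩ := exists_maximal_face (isFace_empty (induced Delta1233 (slice W i)))
    rw [← (hd i).1 s hs hmax]
    exact isSimplicialSphere_Delta1233.isClosedPseudomanifold.card_le (isFace_induced_iff.1 hs).1
  obtain ⟨j, hj, hj4⟩ := exists_eq_three_of_sum_eq hd4 (by omega)
  obtain ⟨p, hp⟩ := exists_forall_mem_iff_of_isClosedPseudomanifold_three
    (by have := hd j; rwa [hj] at this)
  have huniv : ∀ i, i ≠ j → slice W i = Finset.univ := fun i hi =>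
    eq_univ_of_isClosedPseudomanifold_four (by have := hd i; rwa [hj4 i hi] at this)
  -- `W` consists of the neighbours of `(j, p)` in the join: those of `p` in its copy, and all
  -- vertices of the other copies.
  have hW : ∀ q, q ∈ W ↔ q ≠ (j, p) ∧ ((j, p).1 = q.1 → Adj p q.2) := by
    rintro ⟨i, q⟩
    rw [← mem_slice]
    by_cases hi : i = j
    · subst hi
      simp [hp]
    · simp [huniv i hi, hi, Ne.symm hi]
  refine ⟨(j, p), mem_iff_isFace.2 ⟨Finset.singleton_nonempty _, isFace_singleton _⟩,
    SetLike.ext fun s => ?_⟩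
  change s ∈ joinPower k Delta1233 ∧ s ⊆ W ↔ s ∈ joinPower k Delta1233 ∧
    {(j, p)} ∪ s ∈ joinPower k Delta1233 ∧ {(j, p)} ∩ s = ∅
  refine and_congr_right fun hs => ?_
  rw [mem_iff_isFace, isFace_joinPower_Delta1233_iff, ← Finset.disjoint_iff_inter_eq_empty,
    Finset.disjoint_singleton_left]
  have hs' := isFace_joinPower_Delta1233_iff.1 (Or.inr hs)
  constructor
  · intro hsW
    refine ⟨⟨⟨_, Finset.mem_union_left _ (Finset.mem_singleton_self _)⟩, ?_⟩,
      fun hjp => ((hW _).1 (hsW hjp)).1 rfl⟩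
    intro q hq r hr hqr
    simp only [Finset.singleton_union, Finset.mem_insert] at hq hr
    rcases hq with rfl | hq <;> rcases hr with rfl | hr
    · exact adj_refl _
    · exact ((hW r).1 (hsW hr)).2 hqr
    · exact adj_symm _ _ (((hW q).1 (hsW hq)).2 hqr.symm)
    · exact hs' q hq r hr hqr
  · rintro ⟨⟨-, hadj⟩, hjp⟩ q hq
    exact (hW q).2 ⟨fun h => hjp (h ▸ hq), hadj _ (by simp) q (by simp [hq])⟩

end JoinPower

end FlagSphere

theorem mainTheorem5 (k : ℕ) (hk : 1 ≤ k) :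
    FlagSphere.IsFlag (FlagSphere.joinPower k FlagSphere.Delta1233) ∧
    FlagSphere.IsSimplicialSphere (4 * k - 1) (FlagSphere.joinPower k FlagSphere.Delta1233) ∧
    ¬ FlagSphere.IsSuspension (FlagSphere.joinPower k FlagSphere.Delta1233) ∧
    (∀ e : Finset (Fin k × FlagSphere.Vertex),
      ¬ FlagSphere.IsContractibleEdge (FlagSphere.joinPower k FlagSphere.Delta1233) e) ∧
    (∀ E : PreAbstractSimplicialComplex (Fin k × FlagSphere.Vertex),
      FlagSphere.IsInducedEquator (4 * k - 1) (FlagSphere.joinPower k FlagSphere.Delta1233) E →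
      FlagSphere.IsVertexLink (FlagSphere.joinPower k FlagSphere.Delta1233) E) := by
  refine ⟨FlagSphere.isFlag_joinPower_Delta1233, FlagSphere.isSimplicialSphere_Delta1233.joinPower hk,
    FlagSphere.not_isSuspension_joinPower_Delta1233,
    FlagSphere.not_isContractibleEdge_joinPower_Delta1233, ?_⟩
  rintro _ ⟨⟨W, rfl⟩, d, hd, hsphere⟩
  -- The equator has dimension `d` with `d + 1 = 4 * k - 1`, so its facets have `4 * k - 1`
  -- vertices.
  have h := hsphere.isClosedPseudomanifold
  rw [hd] at h
  exact FlagSphere.isVertexLink_of_isClosedPseudomanifold hk h
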